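/- Theorem (extension of $\mathrm{Li}_\bullet$). Let $X=\{x_0,x_1\}$, let $\Omega=\mathbb C\setminus(\,]-\infty,0]\cup[1,+\infty[\,)$ and $\mathcal C=\mathbb C[z,z^{-1},(1-z)^{-1}]$, regarded as functions on $\Omega$, with unit $1_\Omega$. Let $\mathbb C\langle X\rangle\subset\mathbb C\langle\langle X\rangle\rangle$ be the noncommutative polynomials and series, with the shuffle product $\sqcup\!\!\sqcup$, and let $S^*=\sum_{k\ge0}S^k$ (powers for concatenation) for a series $S$ without constant term. The polylogarithms $\mathrm{Li}_w$ $(w\in X^*)$ are the analytic functions on $\Omega$ such that $\mathrm{Li}_{x_0^n}=\log^n(z)/n!$, such that $\mathrm{Li}_{x_0^{s_1-1}x_1\cdots x_0^{s_r-1}x_1}(z)=\sum_{n_1>\cdots>n_r>0}\frac{z^{n_1}}{n_1^{s_1}\cdots n_r^{s_r}}$ for $|z|<1$, and which are extended to all words by compatibility with the shuffle product, i.e. by $(n+1)\,\mathrm{Li}_{ux_1x_0^{n+1}}=\mathrm{Li}_{ux_1x_0^n}\log z-\sum_v\mathrm{Li}_{vx_1x_0^n}$, where $v$ runs, with multiplicity,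 over the words obtained by inserting one letter $x_0$ in $u$. Let $\mathcal C\{\mathrm{Li}_w\}_{w\in X^*}$ be the algebra of functions on $\Omega$ generated over $\mathcal C$ by the $\mathrm{Li}_w$. Let $\mathcal B$ be the family of all products $c\cdot\ell\cdot\mathrm{Li}_{x_0^n}$ with $c\in\{z^k: k\in\mathbb Z\}\cup\{(1-z)^{-l}: l\ge1\}$, $\ell\in\{1\}\cup\{\mathrm{Li}_{ux_1}: u\in X^*\}$ and $n\in\mathbb N$. Its index map is $\mathrm{ind}(c\,\ell\,\mathrm{Li}_{x_0^n})=\kappa(c)+\nu(\ell)$, where $\kappa(z^k)=k$, $\kappa((1-z)^{-l})=0$, $\nu(1)=0$ and $\nu(\mathrm{Li}_{ux_1})=|ux_1|$ (the length of the word). Then: (1) $\mathcal B$ is a $\mathbb C$-basis of $\mathcal C\{\mathrm{Li}_w\}_{w\in X^*}$. Let $\iota_0$ be the operator that is linear on $\mathcal C\{\mathrm{Li}_w\}_{w\in X^*}$ and is given on $b\in\mathcal B$ by $\iota_0(b)=\int_0^z b(s)\frac{ds}{s}$ if $\mathrm{ind}(b)\ge1$ and $\iota_0(b)=\int_1^z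 b(s)\frac{ds}{s}$ if $\mathrm{ind}(b)\le0$, and let $\iota_1(f)=\int_0^z f(s)\frac{ds}{1-s}$. Here $\int_0^z$ and $\int_1^z$ mean the limits for $\varepsilon\to0^+$ of the integrals from $\varepsilon$, resp. $1-\varepsilon$, to $z$ along segments and, if such a limit does not exist, the Hadamard finite part (the constant term after subtraction of a polynomial in $1/\varepsilon$ and $\log\varepsilon$ without constant term). Put $\Im(x_{i_1}\cdots x_{i_n})=\iota_{i_1}\circ\cdots\circ\iota_{i_n}$, $\Im(1_{X^*})=\mathrm{Id}$, and, for a series $T$, $\Im(T)1_\Omega=\sum_{n\ge0}\big(\sum_{|w|=n}\langle T|w\rangle\,\Im(w)1_\Omega\big)$, the sum over $n$ being taken for uniform convergence on compact subsets of $\Omega$. (2) For every $T$ in the shuffle algebra $\mathcal A=\mathbb C[x_0^*]\sqcup\!\!\sqcup \mathbb C[(-x_0)^*]\sqcup\!\!\sqcup \mathbb C[x_1^*]\sqcup\!\!\sqcup \mathbb C\langle X\rangle$ the series $\Im(T)1_\Omega$ converges, uniformly on the compact subsets of $\Omega$, to an element of $\mathcal C\{\mathrm{Li}_w\}_{w\in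 X^*}$, and $$(\mathcal A,\sqcup\!\!\sqcup ,1_{X^*})\longrightarrow(\mathcal C\{\mathrm{Li}_w\}_{w\in X^*},\times,1_\Omega),\qquad T\longmapsto\Im(T)1_\Omega,$$ is a surjective morphism of $\mathbb C$-algebras, with $\Im(w)1_\Omega=\mathrm{Li}_w$ for every word $w\in X^*$ (so it extends $\mathrm{Li}_\bullet$). -/

import Mathlib

open Filter Topology

noncomputable section

/-! ### Noncommutative series over the alphabet `{x₀, x₁}` and the shuffle algebra -/

/-- Words over the alphabet `X = {x₀, x₁}`; the letter `xᵢ` is `i : Fin 2`. -/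
abbrev XWord := List (Fin 2)

/-- The space `ℂ⟨⟨X⟩⟩` of noncommutative formal series; a series is the function sending a word to
its coefficient. The multiplication put on this type below is the shuffle product. -/
def NCSeries : Type := XWord → ℂ

namespace NCSeries

instance : AddCommGroup NCSeries := inferInstanceAs (AddCommGroup (XWord → ℂ))

instance : Module ℂ NCSeries := inferInstanceAs (Module ℂ (XWord → ℂ))

/-- The coefficient `⟨S | w⟩`. -/
def coeff (S : NCSeries) (w : XWord) : ℂ := (show XWord → ℂ from S) w

/-- The series with given coefficients. -/
def ofCoeff (c : XWord → ℂ) : NCSeries := c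

@[simp] theorem coeff_ofCoeff (c : XWord → ℂ) (w : XWord) : coeff (ofCoeff c) w = c w := rfl

@[ext] theorem ext {S T : NCSeries} (h : ∀ w : XWord, coeff S w = coeff T w) : S = T := funext h

@[simp] theorem coeff_zero (w : XWord) : coeff 0 w = 0 := rfl

@[simp] theorem coeff_add (S T : NCSeries) (w : XWord) :
    coeff (S + T) w = coeff S w + coeff T w := rfl

@[simp] theorem coeff_smul (c : ℂ) (S : NCSeries) (w : XWord) :
    coeff (c • S) w = c * coeff S w := rfl

/-- The left residual of a series by a letter: the coefficient of `w` is `⟨S | xᵢ w⟩`. -/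
def residual (i : Fin 2) (S : NCSeries) : NCSeries := ofCoeff fun w => coeff S (i :: w)

/-- The coefficients of the shuffle product: the constant term is multiplicative and the left
residuals by letters are derivations. On words this is the usual recursion
`xu ⧢ yv = x(u ⧢ yv) + y(xu ⧢ v)`. -/
def shuffleCoeff : NCSeries → NCSeries → XWord → ℂ
  | S, T, [] => coeff S [] * coeff T []
  | S, T, i :: w => shuffleCoeff (residual i S) T w + shuffleCoeff S (residual i T) w

/-- The series reduced to a single word. -/
def word (u : XWord) : NCSeries := ofCoeff fun w => if w = u then 1 else 0

instance : Mul NCSeries := ⟨fun S T => ofCoeff (shuffleCoeff S T)⟩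

instance : One NCSeries := ⟨word []⟩

theorem coeff_mul_nil (S T : NCSeries) : coeff (S * T) [] = coeff S [] * coeff T [] := rfl

theorem coeff_mul_cons (S T : NCSeries) (i : Fin 2) (w : XWord) :
    coeff (S * T) (i :: w) = coeff (residual i S * T) w + coeff (S * residual i T) w := rfl

theorem residual_mul (i : Fin 2) (S T : NCSeries) :
    residual i (S * T) = residual i S * T + S * residual i T := rfl

theorem residual_add (i : Fin 2) (S T : NCSeries) :
    residual i (S + T) = residual i S + residual i T := rfl

theorem residual_smul (i : Fin 2) (c : ℂ) (S : NCSeries) :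
    residual i (c • S) = c • residual i S := rfl

theorem residual_one (i : Fin 2) : residual i 1 = 0 := by
  ext w
  change (if i :: w = [] then (1 : ℂ) else 0) = 0
  simp

theorem shuffle_comm (S T : NCSeries) : S * T = T * S := by
  ext w
  induction w generalizing S T with
  | nil => simp [coeff_mul_nil, mul_comm]
  | cons i w ih => rw [coeff_mul_cons, coeff_mul_cons, ih, ih S, add_comm]

theorem shuffle_add (S T U : NCSeries) : S * (T + U) = S * T + S * U := by
  ext w
  induction w generalizing S T U with
  | nil => simp [coeff_mul_nil, mul_add]
  | cons i w ih =>
    rw [coeff_mul_cons, residual_add, ih, ih]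
    simp only [coeff_add, coeff_mul_cons]
    ring

theorem shuffle_smul (c : ℂ) (S T : NCSeries) : S * (c • T) = c • (S * T) := by
  ext w
  induction w generalizing S T with
  | nil => simp only [coeff_mul_nil, coeff_smul]; ring
  | cons i w ih =>
    rw [coeff_mul_cons, residual_smul, ih, ih]
    simp only [coeff_smul, coeff_mul_cons]
    ring

theorem zero_shuffle (S : NCSeries) : 0 * S = 0 := by
  have h := shuffle_smul 0 S 0
  rw [zero_smul, zero_smul] at h
  rw [shuffle_comm, h]

theorem one_shuffle (S : NCSeries) : 1 * S = S := by
  ext w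
  induction w generalizing S with
  | nil =>
    rw [coeff_mul_nil]
    change (if ([] : XWord) = [] then (1 : ℂ) else 0) * coeff S [] = coeff S []
    simp
  | cons i w ih => rw [coeff_mul_cons, residual_one, zero_shuffle, ih]; simp [residual]

theorem shuffle_assoc (S T U : NCSeries) : S * T * U = S * (T * U) := by
  ext w
  induction w generalizing S T U with
  | nil => simp [coeff_mul_nil, mul_assoc]
  | cons i w ih =>
    rw [coeff_mul_cons, coeff_mul_cons, residual_mul, residual_mul, shuffle_add,
      shuffle_comm _ U, shuffle_add, shuffle_comm U, shuffle_comm U]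
    simp only [coeff_add, ih]
    ring

/-- The commutative shuffle algebra `(ℂ⟨⟨X⟩⟩, ⧢, 1)`. -/
instance : CommRing NCSeries where
  __ := (inferInstance : AddCommGroup NCSeries)
  mul := (· * ·)
  one := 1
  mul_assoc := shuffle_assoc
  one_mul := one_shuffle
  mul_one S := by rw [shuffle_comm, one_shuffle]
  left_distrib := shuffle_add
  right_distrib S T U := by rw [shuffle_comm, shuffle_add, shuffle_comm U, shuffle_comm U]
  zero_mul := zero_shuffle
  mul_zero S := by rw [shuffle_comm, zero_shuffle]
  mul_comm := shuffle_comm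

instance : Algebra ℂ NCSeries :=
  Algebra.ofModule
    (fun c S T => by rw [mul_comm, shuffle_smul, mul_comm])
    (fun c S T => shuffle_smul c S T)

/-- The Kleene star `(a₀x₀ + a₁x₁)^* = ∑ₖ (a₀x₀ + a₁x₁)^k` (powers for concatenation): the
coefficient of the word `x_{i₁}⋯x_{iₙ}` is `a_{i₁}⋯a_{iₙ}`. -/
def star (a : Fin 2 → ℂ) : NCSeries := ofCoeff fun w => (w.map a).prod

/-- The shuffle algebra `ℂ⟨X⟩` of noncommutative polynomials (the span of the words, which is
closed under the shuffle product). -/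
def polynomials : Subalgebra ℂ NCSeries := Algebra.adjoin ℂ (Set.range word)

/-- The shuffle algebra `ℂ[x₀^*] ⧢ ℂ[(-x₀)^*] ⧢ ℂ[x₁^*] ⧢ ℂ⟨X⟩`. In a commutative algebra the
span of the products of elements of subalgebras is their join. -/
def starAlgebra : Subalgebra ℂ NCSeries :=
  Algebra.adjoin ℂ {star ![1, 0]} ⊔ Algebra.adjoin ℂ {star ![-1, 0]} ⊔
    Algebra.adjoin ℂ {star ![0, 1]} ⊔ polynomials

theorem word_mem_starAlgebra (w : XWord) : word w ∈ starAlgebra :=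
  (le_sup_right : polynomials ≤ starAlgebra) (Algebra.subset_adjoin ⟨w, rfl⟩)

end NCSeries

/-! ### Polylogarithms on the cleft plane -/

/-- The cleft plane `Ω = ℂ ∖ (]-∞, 0] ∪ [1, +∞[)`. -/
def cleftPlane : Set ℂ := (Complex.ofReal '' (Set.Iic 0 ∪ Set.Ici 1))ᶜ

/-- The algebra of functions on `Ω` in which everything takes place; its unit is `1_Ω`. -/
abbrev CleftFun := cleftPlane → ℂ

/-- The harmonic sum `H_{s₁,…,s_r}(N) = ∑_{N ≥ n₁ > ⋯ > n_r > 0} 1 / (n₁^{s₁} ⋯ n_r^{s_r})`. -/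
def harmonicSum : List ℕ → ℕ → ℂ
  | [], _ => 1
  | s :: l, N => ∑ n ∈ Finset.range N, harmonicSum l n / ((n : ℂ) + 1) ^ s

/-- The power series `∑_{n₁ > ⋯ > n_r > 0} z^{n₁} / (n₁^{s₁} ⋯ n_r^{s_r})` (`n₁ = n + 1`). -/
def polylogSeries : List ℕ → ℂ → ℂ
  | [], _ => 1
  | s :: l, z => ∑' n : ℕ, z ^ (n + 1) * harmonicSum l n / ((n : ℂ) + 1) ^ s

/-- The analytic function on `Ω` given by the power series above where `|z| < 1`. -/
def polylogCont (s : List ℕ) : CleftFun :=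
  open Classical in
  if h : ∃ F : ℂ → ℂ, DifferentiableOn ℂ F cleftPlane ∧
      ∀ z ∈ cleftPlane, ‖z‖ < 1 → F z = polylogSeries s z
  then fun z => h.choose z else 0

/-- `compositionOf 1` sends `x₀^{s₁-1}x₁⋯x₀^{s_r-1}x₁` to `(s₁, …, s_r)`; the first argument is the
current part, that is one plus the number of letters `x₀` just read. -/
def compositionOf : ℕ → XWord → List ℕ
  | _, [] => []
  | s, i :: w => if i = 0 then compositionOf (s + 1) w else s :: compositionOf 1 w

/-- `z ↦ log z` on `Ω`. -/
def cleftLog : CleftFun := fun z => Complex.log z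

/-- `polylogAux u n` is `Li_{u x₁ x₀^n}`. For `n = 0` it is given by the power series, and then by
compatibility with the shuffle product, through the identity
`(n+1) u x₁ x₀^{n+1} = u x₁ x₀^n ⧢ x₀ - (u ⧢ x₀) x₁ x₀^n`, where `u ⧢ x₀` is the sum of the words
obtained by inserting a letter `x₀` into `u`. -/
def polylogAux : XWord → ℕ → CleftFun
  | u, 0 => polylogCont (compositionOf 1 (u ++ [1]))
  | u, n + 1 => ((n : ℂ) + 1)⁻¹ • (polylogAux u n * cleftLog -
      ∑ i ∈ Finset.range (u.length + 1), polylogAux (u.insertIdx i 0) n)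

/-- The polylogarithm `Li_w` for an arbitrary word `w`; `Li_{x₀^n} = log^n / n!`. The word is read
from its right end: `n` is the number of its final letters `x₀`. -/
def polylog (w : XWord) : CleftFun :=
  let n := (w.reverse.takeWhile (· = 0)).length
  match w.reverse.dropWhile (· = 0) with
  | [] => (n.factorial : ℂ)⁻¹ • cleftLog ^ n
  | _ :: r => polylogAux r.reverse n

/-- The ring `𝒞 = ℂ[z, z⁻¹, (1 - z)⁻¹]` of functions on `Ω`. -/
def rationalAlg : Subalgebra ℂ CleftFun :=
  Algebra.adjoin ℂ {(fun z => (z : ℂ) : CleftFun), (fun z => (z : ℂ)⁻¹ : CleftFun),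
    (fun z => (1 - (z : ℂ))⁻¹ : CleftFun)}

/-- The algebra `𝒞{Li_w}_{w ∈ X^*}` generated over `𝒞` by the polylogarithms. -/
def polylogAlg : Subalgebra ℂ CleftFun :=
  (Algebra.adjoin rationalAlg (Set.range polylog)).restrictScalars ℂ

/-! ### The basis `ℬ` and the integration operators -/

/-- Indices of `ℬ`: a rational factor (`inl k` for `z^k`, `inr l` for `(1 - z)^{-(l+1)}`), a factor
`1` (`none`) or `Li_{u x₁}` (`some u`), and the exponent of a factor `Li_{x₀^n}`. -/
abbrev BIndex := (ℤ ⊕ ℕ) × Option XWord × ℕ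

/-- The family `ℬ`. -/
def polylogB (b : BIndex) : CleftFun :=
  (match b.1 with
    | .inl k => fun z => (z : ℂ) ^ k
    | .inr l => fun z => ((1 - (z : ℂ)) ^ (l + 1))⁻¹) *
  (match b.2.1 with
    | none => 1
    | some u => polylog (u ++ [1])) *
  polylog (List.replicate b.2.2 0)

/-- The index map `ind : ℬ → ℤ`. -/
def indB (b : BIndex) : ℤ :=
  (match b.1 with
    | .inl k => k
    | .inr _ => 0) +
  (match b.2.1 with
    | none => 0
    | some u => (u ++ [1]).length)

/-- Extension by zero of a function on `Ω`. -/
def extendCleft (f : CleftFun) : ℂ → ℂ :=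
  open Classical in fun s => if h : s ∈ cleftPlane then f ⟨s, h⟩ else 0

/-- `∫_a^z f(s) g(s) ds` along the segment from `a` to `z`. It is used for `a ∈ ]0, 1[` and `z ∈ Ω`
only, and then the segment is contained in `Ω`. -/
def segInt (f : CleftFun) (g : ℂ → ℂ) (a z : ℂ) : ℂ :=
  ∫ t in (0 : ℝ)..1, extendCleft f (a + t * (z - a)) * g (a + t * (z - a)) * (z - a)

/-- `c` is the (Hadamard) finite part of `φ(ε)` as `ε → 0⁺`: after subtraction of a polynomial in
`1/ε` and `log ε` without constant term, `φ(ε)` tends to `c`. If `φ(ε)` itself has a limit, the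
finite part is this limit. -/
def HasFinitePart (φ : ℝ → ℂ) (c : ℂ) : Prop :=
  ∃ Q : ℕ × ℕ →₀ ℂ, Q (0, 0) = 0 ∧
    Tendsto (fun ε : ℝ => φ ε - Q.sum fun p q => q * (((ε⁻¹ ^ p.1 * Real.log ε ^ p.2 : ℝ)) : ℂ))
      (𝓝[>] 0) (𝓝 c)

theorem tendsto_exp_monomial_ratio {i j i' j' : ℕ} (h : i' < i ∨ (i' = i ∧ j' < j)) :
    Tendsto (fun x : ℝ => (Real.exp x ^ i' * (-x) ^ j') / (Real.exp x ^ i * (-x) ^ j)) atTop (𝓝 0) := by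
  rcases h with h | ⟨rfl, h⟩
  · obtain ⟨d, rfl⟩ := Nat.exists_eq_add_of_lt h
    have h1 : Tendsto (fun x : ℝ => x ^ j' * Real.exp (-x)) atTop (𝓝 0) :=
      Real.tendsto_pow_mul_exp_neg_atTop_nhds_zero j'
    refine squeeze_zero_norm' ?_ h1
    filter_upwards [eventually_ge_atTop 1] with x hx
    have hx0 : 0 < x := by linarith
    rw [norm_div, norm_mul, norm_mul, norm_pow, norm_pow, norm_pow, norm_pow, norm_neg,
      Real.norm_of_nonneg hx0.le, Real.norm_of_nonneg (Real.exp_pos x).le, Real.exp_neg]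
    have e1 : 1 ≤ Real.exp x := Real.one_le_exp hx0.le
    have e2 : 1 ≤ Real.exp x ^ d := one_le_pow₀ e1
    have e3 : 1 ≤ x ^ j := one_le_pow₀ hx
    have e4 := Real.exp_pos x
    have : Real.exp x ^ i' * x ^ j' / (Real.exp x ^ (i' + d + 1) * x ^ j)
        = (x ^ j' * (Real.exp x)⁻¹) / (Real.exp x ^ d * x ^ j) := by
      field_simp
      ring
    rw [this]
    apply div_le_self (by positivity)
    nlinarith
  · obtain ⟨d, rfl⟩ := Nat.exists_eq_add_of_lt h
    have h1 : Tendsto (fun x : ℝ => x⁻¹) atTop (𝓝 0) := tendsto_inv_atTop_zero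
    refine squeeze_zero_norm' ?_ h1
    filter_upwards [eventually_ge_atTop 1] with x hx
    have hx0 : 0 < x := by linarith
    rw [norm_div, norm_mul, norm_mul, norm_pow, norm_pow, norm_pow, norm_neg,
      Real.norm_of_nonneg hx0.le, Real.norm_of_nonneg (Real.exp_pos x).le]
    have e3 : 1 ≤ x ^ d := one_le_pow₀ hx
    have e4 := Real.exp_pos x
    have : Real.exp x ^ i' * x ^ j' / (Real.exp x ^ i' * x ^ (j' + d + 1))
        = x⁻¹ / x ^ d := by
      field_simp
      ring
    rw [this]
    exact div_le_self (by positivity) e3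

theorem finitePart_eq_zero_of_tendsto (Q : ℕ × ℕ →₀ ℂ) (h0 : Q (0, 0) = 0) (c : ℂ)
    (h : Tendsto (fun ε : ℝ => Q.sum fun p q => q * (((ε⁻¹ ^ p.1 * Real.log ε ^ p.2 : ℝ)) : ℂ))
      (𝓝[>] 0) (𝓝 c)) : c = 0 := by
  by_cases hQ : Q = 0
  · subst hQ
    simpa using (tendsto_nhds_unique h (by simp : Tendsto _ _ (𝓝 (0:ℂ))))
  exfalso
  have hlim : Tendsto (fun x : ℝ => Real.exp (-x)) atTop (𝓝[>] 0) :=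
    tendsto_nhdsWithin_iff.2 ⟨Real.tendsto_exp_neg_atTop_nhds_zero, by
      filter_upwards with x using Real.exp_pos _⟩
  have h := h.comp hlim
  simp only [Function.comp_def, ← Real.exp_neg, neg_neg, Real.log_exp] at h
  obtain ⟨m, hm, hmax⟩ := Q.support.exists_max_image (fun p => toLex p)
    (Finsupp.support_nonempty_iff.2 hQ)
  have hm0 : Q m ≠ 0 := Finsupp.mem_support_iff.1 hm
  have hmne : m ≠ (0, 0) := fun e => hm0 (e ▸ h0)
  obtain ⟨i, j⟩ := m
  have hlt : ∀ p ∈ Q.support, p ≠ (i, j) → p.1 < i ∨ (p.1 = i ∧ p.2 < j) := by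
    intro p hp hne
    have := (hmax p hp).lt_of_ne (by simpa using hne)
    simpa [Prod.Lex.lt_iff] using this
  have h00 : 0 < i ∨ (0 = i ∧ 0 < j) := by
    by_contra hcon
    apply hmne
    ext <;> simp <;> omega
  have hz := Complex.continuous_ofReal.continuousAt.tendsto.comp (tendsto_exp_monomial_ratio h00)
  have h2 := h.mul hz
  simp only [Complex.ofReal_zero, mul_zero] at h2
  have h3 : Tendsto (fun x : ℝ => ∑ p ∈ Q.support, Q p *
      (((Real.exp x ^ p.1 * (-x) ^ p.2) / (Real.exp x ^ i * (-x) ^ j) : ℝ) : ℂ)) atTop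
      (𝓝 (∑ p ∈ Q.support, if p = (i, j) then Q p else 0)) := by
    refine tendsto_finsetSum _ fun p hp => ?_
    split_ifs with hpe
    · subst hpe
      refine tendsto_const_nhds.congr' ?_
      filter_upwards [eventually_ge_atTop 1] with x hx
      rw [div_self, Complex.ofReal_one, mul_one]
      have : x ≠ 0 := by linarith
      exact mul_ne_zero (pow_ne_zero _ (Real.exp_pos x).ne') (pow_ne_zero _ (neg_ne_zero.2 this))
    · have := (Complex.continuous_ofReal.continuousAt.tendsto.comp
        (tendsto_exp_monomial_ratio (hlt p hp hpe))).const_mul (Q p)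
      simpa using this
  rw [Finset.sum_ite_eq' , if_pos hm] at h3
  refine hm0 (tendsto_nhds_unique h3 (h2.congr fun x => ?_))
  simp only [Finsupp.sum, Function.comp_def, Finset.sum_mul, pow_zero, mul_one]
  refine Finset.sum_congr rfl fun p _ => ?_
  push_cast
  ring

/-- The finite part is well defined. -/
theorem HasFinitePart.unique {φ : ℝ → ℂ} {c d : ℂ} (hc : HasFinitePart φ c)
    (hd : HasFinitePart φ d) : c = d := by
  obtain ⟨Q, hQ, hc⟩ := hc
  obtain ⟨R, hR, hd⟩ := hd
  refine sub_eq_zero.1 (finitePart_eq_zero_of_tendsto (R - Q) (by simp [hQ, hR]) (c - d)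
    ((hc.sub hd).congr fun ε => ?_))
  rw [Finsupp.sum_sub_index (fun a b₁ b₂ => by ring)]
  ring

/-- The finite part of `φ(ε)` as `ε → 0⁺`, that is the limit if the limit exists. -/
def finitePart (φ : ℝ → ℂ) : ℂ :=
  open Classical in if h : ∃ c, HasFinitePart φ c then h.choose else 0

theorem finitePart_eq {φ : ℝ → ℂ} {c : ℂ} (hc : HasFinitePart φ c) : finitePart φ = c := by
  have h : ∃ c, HasFinitePart φ c := ⟨c, hc⟩
  rw [finitePart, dif_pos h]
  exact h.choose_spec.unique hc

/-- The finite part is the limit if there is one. -/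
theorem finitePart_eq_of_tendsto {φ : ℝ → ℂ} {c : ℂ} (hc : Tendsto φ (𝓝[>] 0) (𝓝 c)) :
    finitePart φ = c :=
  finitePart_eq ⟨0, rfl, by simpa using hc⟩

/-- `∫_0^z f(s) g(s) ds`, as the limit (in general, the finite part) of `∫_ε^z`. -/
def intFromZero (f : CleftFun) (g : ℂ → ℂ) : CleftFun :=
  fun z => finitePart fun ε => segInt f g ε z

/-- `∫_1^z f(s) g(s) ds`, as the limit (in general, the finite part) of `∫_{1-ε}^z`. -/
def intFromOne (f : CleftFun) (g : ℂ → ℂ) : CleftFun :=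
  fun z => finitePart fun ε => segInt f g (1 - ε) z

/-- `ι₀` on the elements of `ℬ`. -/
def iota0B (b : BIndex) : CleftFun :=
  if 1 ≤ indB b then intFromZero (polylogB b) (fun s => s⁻¹)
  else intFromOne (polylogB b) (fun s => s⁻¹)

/-- The operator `ι₀`, extended linearly from the basis `ℬ` to its span `𝒞{Li_w}` (and by the
irrelevant value `0` to the functions outside this space). -/
def iota0 (f : CleftFun) : CleftFun :=
  open Classical in
  if h : LinearIndependent ℂ polylogB ∧ f ∈ Submodule.span ℂ (Set.range polylogB)
  then (h.1.repr ⟨f, h.2⟩).sum fun b c => c • iota0B b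
  else 0

/-- The operator `ι₁ f = ∫_0^z f(s) ds / (1 - s)`. -/
def iota1 (f : CleftFun) : CleftFun := intFromZero f fun s => (1 - s)⁻¹

/-- `ℑ(w)` for a word: `ℑ(x_{i₁}⋯x_{iₙ}) = ι_{i₁} ∘ ⋯ ∘ ι_{iₙ}`. -/
def imOp : XWord → CleftFun → CleftFun
  | [], f => f
  | i :: w, f => if i = 0 then iota0 (imOp w f) else iota1 (imOp w f)

/-- `ℑ(Tₙ) f` where `Tₙ = ∑_{|w| = n} ⟨T | w⟩ w` is the homogeneous component of degree `n`
of the series `T`. -/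
def imHom (T : NCSeries) (n : ℕ) (f : CleftFun) : CleftFun :=
  ∑ v : Fin n → Fin 2, T.coeff (List.ofFn v) • imOp (List.ofFn v) f

/-- `g = ℑ(T) f = ∑ₙ ℑ(Tₙ) f`, the series converging uniformly on the compact subsets of `Ω`. -/
def HasIm (T : NCSeries) (f g : CleftFun) : Prop :=
  TendstoLocallyUniformly (fun N => ∑ n ∈ Finset.range N, imHom T n f) g atTop

end

noncomputable section

/-! ### Geometry of the cleft plane -/

/-! The polylogarithms are governed by two facts. They solve the system `d Li_{xᵢ w} = ωᵢ Li_w` with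
`ω₀ = dz/z`, `ω₁ = dz/(1-z)` (`hasCleftDeriv_polylog_cons`), and `Li_w` vanishes at the origin
faster than any power of `log` decreases as soon as `w` contains `x₁` (`vanishesAtZero_polylog`). A
function on the connected set `Ω` with zero derivative and with behaviour `κ log^(n+1) + o(1)` at
`0` is zero (`eq_zero_of_hasCleftDeriv_zero`), so identities between polylogarithms can be checked
on derivatives, by induction on the degree.

Shuffle compatibility follows: left residuals are derivations of the shuffle product, so the
homogeneous parts of `S ⧢ T` have the right derivatives (`polylogHom_mul`). Where the series over
the degree converges normally, the Cauchy product makes `T ↦ ∑ₙ ∑_{|w|=n} ⟨T|w⟩ Li_w`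
multiplicative. The stars of `x₀`, `-x₀`, `x₁` become exponential series with sums `z`, `z⁻¹`,
`(1-z)⁻¹`. Together with the words these generate the target, hence surjectivity.

Independence of `ℬ` (`evalL_injective`): a relation with polynomial coefficients is differentiated
by `z(1-z) d/dz`, which lowers the weight of the products `ℓ Li_{x₀^n}` by one. Eliminating between
the relation and its derivative shows that the top coefficients are constant multiples of one
polynomial `p`. The next weight then exhibits `A/z + B/(1-z)` as the derivative of a rational
function; residues force `A = B = 0`, and all the constants vanish. Partial fractions for the
rational factors finish the argument. Spanning uses the shuffle product and the recursion relating
`Li_{u x₁ x₀^n}` to the products `Li_{v x₁} log^m`.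

Finally `ℑ(w)1 = Li_w` (`imOp_one`): `log^n/n!` has index `0` and is integrated from `1`, where
`log` vanishes, while `Li_{u x₁ x₀^n}` is a combination of elements of `ℬ` of positive index,
integrated from `0`, where the primitives vanish. All these integrals are genuine limits. -/

theorem mem_cleftPlane_iff {z : ℂ} :
    z ∈ cleftPlane ↔ z ∈ Complex.slitPlane ∧ 1 - z ∈ Complex.slitPlane := by
  simp only [cleftPlane, Set.mem_compl_iff, Set.mem_image, Set.mem_union, Set.mem_Iic, Set.mem_Ici,
    Complex.mem_slitPlane_iff, Complex.sub_re, Complex.one_re, Complex.sub_im, Complex.one_im]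
  constructor
  · intro h
    constructor
    · by_contra! hc
      exact h ⟨z.re, Or.inl hc.1, Complex.ext (by simp) (by simp [hc.2])⟩
    · by_contra! hc
      exact h ⟨z.re, Or.inr (by linarith), Complex.ext (by simp) (by simp; linarith)⟩
  · rintro ⟨h1, h2⟩ ⟨x, hx, rfl⟩
    simp at h1 h2 hx
    rcases hx with hx | hx <;> linarith

theorem isOpen_cleftPlane : IsOpen cleftPlane := by
  have : cleftPlane = Complex.slitPlane ∩ (fun z => 1 - z) ⁻¹' Complex.slitPlane := by
    ext z; exact mem_cleftPlane_iff
  rw [this]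
  exact Complex.isOpen_slitPlane.inter (Complex.isOpen_slitPlane.preimage (by fun_prop))

theorem ofReal_mem_cleftPlane {x : ℝ} (h0 : 0 < x) (h1 : x < 1) : (x : ℂ) ∈ cleftPlane := by
  rw [mem_cleftPlane_iff]
  simp [Complex.mem_slitPlane_iff, h0, h1]

theorem cleftPlane_ne_zero {z : ℂ} (hz : z ∈ cleftPlane) : z ≠ 0 :=
  Complex.slitPlane_ne_zero (mem_cleftPlane_iff.1 hz).1

theorem one_sub_cleftPlane_ne_zero {z : ℂ} (hz : z ∈ cleftPlane) : 1 - z ≠ 0 :=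
  Complex.slitPlane_ne_zero (mem_cleftPlane_iff.1 hz).2

/-- The imaginary part along the segment is `t · im z`. It vanishes only at `t = 0` or for real `z`,
and then the point is a convex combination of points of `]0, 1[`. -/
theorem segment_mem_cleftPlane {x : ℝ} (h0 : 0 < x) (h1 : x < 1) {z : ℂ} (hz : z ∈ cleftPlane)
    {t : ℝ} (ht : t ∈ Set.Icc (0 : ℝ) 1) : (x : ℂ) + t * (z - x) ∈ cleftPlane := by
  rw [mem_cleftPlane_iff, Complex.mem_slitPlane_iff, Complex.mem_slitPlane_iff] at *
  obtain ⟨ht0, ht1⟩ := ht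
  simp only [Complex.add_re, Complex.ofReal_re, Complex.mul_re, Complex.sub_re, Complex.ofReal_im,
    Complex.sub_im, zero_mul, sub_zero, Complex.add_im, Complex.mul_im, add_zero, zero_add,
    Complex.one_re, Complex.one_im, zero_sub, neg_ne_zero] at hz ⊢
  rcases ht0.eq_or_lt with rfl | ht0
  · simp [h0, h1]
  · by_cases hi : z.im = 0
    · simp only [hi, ne_eq, not_true_eq_false, or_false] at hz
      have h2 : 0 < t * z.re := mul_pos ht0 hz.1
      have h3 : 0 < t * (1 - z.re) := mul_pos ht0 hz.2
      have h4 : 0 ≤ (1 - t) * x := mul_nonneg (by linarith) h0.le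
      have h5 : 0 ≤ (1 - t) * (1 - x) := mul_nonneg (by linarith) (by linarith)
      exact ⟨Or.inl (by nlinarith), Or.inl (by nlinarith)⟩
    · have : t * z.im ≠ 0 := mul_ne_zero ht0.ne' hi
      exact ⟨Or.inr this, Or.inr this⟩

theorem starConvex_cleftPlane : StarConvex ℝ (((1 / 2 : ℝ) : ℂ)) cleftPlane := by
  rw [starConvex_iff_segment_subset]
  intro z hz w hw
  rw [segment_eq_image'] at hw
  obtain ⟨t, ht, rfl⟩ := hw
  simpa using segment_mem_cleftPlane (x := 1 / 2) (by norm_num) (by norm_num) hz ht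

theorem isPreconnected_cleftPlane : IsPreconnected cleftPlane :=
  (starConvex_cleftPlane.isPathConnected
    (ofReal_mem_cleftPlane (by norm_num) (by norm_num))).isConnected.isPreconnected

/-! ### Primitives on the plane cut along `[1, +∞[` -/

/-- The plane cut along `[1, +∞[`. -/
def cutPlane : Set ℂ := {z | 1 - z ∈ Complex.slitPlane}

theorem isOpen_cutPlane : IsOpen cutPlane :=
  Complex.isOpen_slitPlane.preimage (by fun_prop)

theorem cleftPlane_subset_cutPlane : cleftPlane ⊆ cutPlane := fun _ hz =>
  (mem_cleftPlane_iff.1 hz).2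

theorem zero_mem_cutPlane : (0 : ℂ) ∈ cutPlane := by
  simp [cutPlane]

theorem ball_subset_cutPlane : Metric.ball (0 : ℂ) 1 ⊆ cutPlane := by
  intro z hz
  have h : ‖z‖ < 1 := by simpa using hz
  have := (Complex.re_le_norm z).trans_lt h
  simp [cutPlane, Complex.mem_slitPlane_iff]
  exact Or.inl this

theorem mul_mem_cutPlane {z : ℂ} (hz : z ∈ cutPlane) {t : ℝ} (ht : t ∈ Set.Icc (0 : ℝ) 1) :
    (t : ℂ) * z ∈ cutPlane := by
  obtain ⟨ht0, ht1⟩ := ht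
  simp only [cutPlane, Set.mem_ofPred_eq, Complex.mem_slitPlane_iff, Complex.sub_re, Complex.one_re,
    Complex.sub_im, Complex.one_im, Complex.mul_re, Complex.mul_im, Complex.ofReal_re,
    Complex.ofReal_im] at hz ⊢
  rcases ht0.eq_or_lt with rfl | ht0
  · simp
  · by_cases hi : z.im = 0
    · left
      have : z.re < 1 := by simpa [hi] using hz
      nlinarith
    · right
      have : t * z.im ≠ 0 := mul_ne_zero ht0.ne' hi
      simpa using ⟨ht0.ne', hi⟩

/-- The cut plane is star-shaped about `0`, so `F(z) = ∫₀¹ f(tz) z dt` makes sense. Working here and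
not on `Ω` keeps the functions holomorphic at the origin, which later gives their decay there. -/
theorem exists_primitive_cutPlane {f : ℂ → ℂ} (hf : DifferentiableOn ℂ f cutPlane) :
    ∃ F : ℂ → ℂ, F 0 = 0 ∧ ∀ z ∈ cutPlane, HasDerivAt F (f z) z := by
  refine ⟨fun z => ∫ t in (0 : ℝ)..1, f (t * z) * z, by simp, fun z hz => ?_⟩
  have hf' : DifferentiableOn ℂ (deriv f) cutPlane := hf.deriv isOpen_cutPlane
  obtain ⟨r, hr, hrs⟩ := Metric.nhds_basis_closedBall.mem_iff.1 (isOpen_cutPlane.mem_nhds hz)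
  have hmaps : Set.MapsTo (fun p : ℝ × ℂ => (p.1 : ℂ) * p.2)
      (Set.Icc (0 : ℝ) 1 ×ˢ Metric.closedBall z r) cutPlane :=
    fun p hp => mul_mem_cutPlane (hrs hp.2) hp.1
  set G : ℝ → ℂ → ℂ := fun t w => deriv f (t * w) * (t * w) + f (t * w) with hG
  have hGc : ContinuousOn (fun p : ℝ × ℂ => G p.1 p.2)
      (Set.Icc (0 : ℝ) 1 ×ˢ Metric.closedBall z r) := by
    have hm : Continuous (fun p : ℝ × ℂ => (p.1 : ℂ) * p.2) := by fun_prop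
    exact ((hf'.continuousOn.comp hm.continuousOn hmaps).mul hm.continuousOn).add
      (hf.continuousOn.comp hm.continuousOn hmaps)
  obtain ⟨C, hC⟩ := (isCompact_Icc.prod (isCompact_closedBall z r)).exists_bound_of_continuousOn hGc
  have hcont : ∀ w ∈ Metric.closedBall z r, ContinuousOn (fun t : ℝ => f (t * w) * w)
      (Set.Icc (0 : ℝ) 1) := fun w hw =>
    (hf.continuousOn.comp (by fun_prop) fun t ht => mul_mem_cutPlane (hrs hw) ht).mul
      continuousOn_const
  have hGz : ContinuousOn (fun t : ℝ => G t z) (Set.Icc (0 : ℝ) 1) :=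
    hGc.comp (f := fun t : ℝ => (t, z)) (by fun_prop) fun t ht =>
      ⟨ht, Metric.mem_closedBall_self hr.le⟩
  have hui : Set.uIoc (0 : ℝ) 1 = Set.Ioc 0 1 := Set.uIoc_of_le zero_le_one
  have key := (intervalIntegral.hasDerivAt_integral_of_dominated_loc_of_deriv_le
    (μ := MeasureTheory.volume) (F := fun w t => f ((t : ℝ) * w) * w) (F' := fun w t => G t w)
    (x₀ := z) (a := 0) (b := 1) (bound := fun _ => C) (s := Metric.ball z r)
    (Metric.ball_mem_nhds z hr) ?_ ?_ ?_ ?_ ?_ ?_).2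
  · refine key.congr_deriv ?_
    -- The `z`-derivative `G t z` of the integrand is also the `t`-derivative of `t f(tz)`, so its
    -- integral over `[0, 1]` is `f z`.
    have hd : ∀ t ∈ Set.uIcc (0 : ℝ) 1, HasDerivAt (fun t : ℝ => (t : ℂ) * f (t * z)) (G t z) t := by
      intro t ht
      rw [Set.uIcc_of_le zero_le_one] at ht
      have h1 : HasDerivAt f (deriv f (t * z)) (t * z) :=
        (hf.differentiableAt (isOpen_cutPlane.mem_nhds (mul_mem_cutPlane hz ht))).hasDerivAt
      have h2 : HasDerivAt (fun t : ℂ => t * z) z t := by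
        simpa using (hasDerivAt_id (t : ℂ)).mul_const z
      have h3 := ((hasDerivAt_id (t : ℂ)).mul (h1.comp (t : ℂ) h2)).comp_ofReal
      refine h3.congr_deriv ?_
      simp only [hG, Function.comp_apply, id]
      ring
    rw [intervalIntegral.integral_eq_sub_of_hasDerivAt hd]
    · simp
    · apply ContinuousOn.intervalIntegrable
      rwa [Set.uIcc_of_le zero_le_one]
  · filter_upwards [Metric.ball_mem_nhds z hr] with w hw
    rw [hui]
    exact ((hcont w (Metric.ball_subset_closedBall hw)).mono
      Set.Ioc_subset_Icc_self).aestronglyMeasurable measurableSet_Ioc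
  · apply ContinuousOn.intervalIntegrable
    rw [Set.uIcc_of_le zero_le_one]
    exact hcont z (Metric.mem_closedBall_self hr.le)
  · rw [hui]
    exact (hGz.mono Set.Ioc_subset_Icc_self).aestronglyMeasurable measurableSet_Ioc
  · refine Filter.Eventually.of_forall fun t ht w hw => ?_
    rw [hui] at ht
    exact hC (t, w) ⟨Set.Ioc_subset_Icc_self ht, Metric.ball_subset_closedBall hw⟩
  · simp
  · refine Filter.Eventually.of_forall fun t ht w hw => ?_
    rw [hui] at ht
    have h1 : HasDerivAt f (deriv f (t * w)) (t * w) :=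
      (hf.differentiableAt (isOpen_cutPlane.mem_nhds (mul_mem_cutPlane
        (hrs (Metric.ball_subset_closedBall hw)) (Set.Ioc_subset_Icc_self ht)))).hasDerivAt
    have h2 : HasDerivAt (fun w : ℂ => (t : ℂ) * w) t w := by
      simpa using (hasDerivAt_id w).const_mul (t : ℂ)
    refine ((h1.comp w h2).mul (hasDerivAt_id w)).congr_deriv ?_
    simp only [hG, Function.comp_apply, id]
    ring

/-! ### The power series -/

theorem norm_inv_pow_le_one (n s : ℕ) : ‖(((n : ℂ) + 1) ^ s)⁻¹‖ ≤ 1 := by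
  rw [norm_inv, norm_pow]
  apply inv_le_one_of_one_le₀
  apply one_le_pow₀
  have : ((n : ℂ) + 1) = ((n + 1 : ℕ) : ℂ) := by push_cast; rfl
  rw [this, Complex.norm_natCast]
  simp

/-- A crude bound suffices: polynomial growth is absorbed by `r ^ n` with `r < 1`. -/
theorem norm_harmonicSum_le (l : List ℕ) (N : ℕ) : ‖harmonicSum l N‖ ≤ ((N : ℝ) + 1) ^ l.length := by
  induction l generalizing N with
  | nil => simp [harmonicSum]
  | cons s l ih =>
    rw [harmonicSum]
    calc _ ≤ ∑ n ∈ Finset.range N, ‖harmonicSum l n / ((n : ℂ) + 1) ^ s‖ := norm_sum_le _ _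
      _ ≤ ∑ n ∈ Finset.range N, ((N : ℝ) + 1) ^ l.length := by
        refine Finset.sum_le_sum fun n hn => ?_
        rw [div_eq_mul_inv, norm_mul]
        have hn : (n : ℝ) ≤ N := by exact_mod_cast (Finset.mem_range.1 hn).le
        calc _ ≤ ((n : ℝ) + 1) ^ l.length * 1 :=
              mul_le_mul (ih n) (norm_inv_pow_le_one n s) (norm_nonneg _) (by positivity)
          _ ≤ _ := by rw [mul_one]; gcongr
      _ ≤ _ := by
        simp only [Finset.sum_const, Finset.card_range, nsmul_eq_mul, List.length_cons, pow_succ]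
        rw [mul_comm]
        gcongr
        linarith

theorem summable_poly_geometric (k : ℕ) {r : ℝ} (h0 : 0 ≤ r) (h1 : r < 1) :
    Summable fun n : ℕ => ((n : ℝ) + 1) ^ k * r ^ n := by
  rcases h0.eq_or_lt with rfl | h0
  · refine summable_of_ne_finset_zero (s := {0}) fun n hn => ?_
    simp at hn
    simp [hn]
  · have h := (summable_nat_add_iff 1).2 (summable_pow_mul_geometric_of_norm_lt_one k
      (r := r) (by rwa [Real.norm_of_nonneg h0.le]))
    refine (h.mul_right r⁻¹).congr fun n => ?_
    push_cast
    field_simp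
    ring

theorem polylogSeries_zero (s : ℕ) (l : List ℕ) : polylogSeries (s :: l) 0 = 0 := by
  simp [polylogSeries]

/-- The derivative of the power series. -/
theorem hasDerivAt_polylogSeries (s : ℕ) (l : List ℕ) {z : ℂ} (hz : ‖z‖ < 1) :
    HasDerivAt (polylogSeries (s :: l))
      (∑' n : ℕ, z ^ n * (((n : ℂ) + 1) * harmonicSum l n / ((n : ℂ) + 1) ^ s)) z := by
  obtain ⟨r, hr, hr1⟩ := exists_between hz
  have hr0 : 0 < r := (norm_nonneg z).trans_lt hr
  have hu := summable_poly_geometric (l.length + 1) hr0.le hr1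
  refine hasDerivAt_tsum_of_isPreconnected
    (g := fun (n : ℕ) (z : ℂ) => z ^ (n + 1) * harmonicSum l n / ((n : ℂ) + 1) ^ s)
    (g' := fun (n : ℕ) (z : ℂ) =>
      z ^ n * (((n : ℂ) + 1) * harmonicSum l n / ((n : ℂ) + 1) ^ s))
    (t := Metric.ball 0 r) (y₀ := 0) hu Metric.isOpen_ball
    (convex_ball 0 r).isPreconnected ?_ ?_ (by simpa using hr0) ?_ (by simpa using hr)
  · intro n y _
    have h := (hasDerivAt_pow (n + 1) y).mul_const (harmonicSum l n / ((n : ℂ) + 1) ^ s)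
    refine (h.congr_deriv ?_).congr_of_eventuallyEq (Eventually.of_forall fun y => ?_)
    · push_cast
      ring
    · exact mul_div_assoc _ _ _
  · intro n y hy
    have hy : ‖y‖ < r := by simpa using hy
    rw [div_eq_mul_inv, norm_mul, norm_mul, norm_mul, norm_pow, mul_comm]
    have e : ‖(n : ℂ) + 1‖ = (n : ℝ) + 1 := by
      have : ((n : ℂ) + 1) = ((n + 1 : ℕ) : ℂ) := by push_cast; rfl
      rw [this, Complex.norm_natCast]; push_cast; rfl
    rw [e]
    gcongr
    calc _ ≤ ((n : ℝ) + 1) * ((n : ℝ) + 1) ^ l.length * 1 :=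
          mul_le_mul (mul_le_mul_of_nonneg_left (norm_harmonicSum_le l n) (by positivity))
            (norm_inv_pow_le_one n s) (norm_nonneg _) (by positivity)
      _ = _ := by ring
  · simp only [ne_eq, Nat.add_eq_zero_iff, one_ne_zero, and_false, not_false_eq_true, zero_pow,
      zero_mul, zero_div]
    exact summable_zero

theorem polylogSeries_deriv_mul {s : ℕ} {l : List ℕ} {z : ℂ} :
    z * (∑' n : ℕ, z ^ n * (((n : ℂ) + 1) * harmonicSum l n / ((n : ℂ) + 1) ^ (s + 1))) =
      polylogSeries (s :: l) z := by
  rw [polylogSeries, ← tsum_mul_left]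
  refine tsum_congr fun n => ?_
  have : ((n : ℂ) + 1) ≠ 0 := Nat.cast_add_one_ne_zero n
  field_simp
  ring

theorem summable_pow_mul_harmonicSum (l : List ℕ) {z : ℂ} (hz : ‖z‖ < 1) :
    Summable fun n : ℕ => z ^ n * harmonicSum l n := by
  refine Summable.of_norm_bounded (summable_poly_geometric l.length (norm_nonneg z) hz) fun n => ?_
  rw [norm_mul, norm_pow, mul_comm]
  gcongr
  exact norm_harmonicSum_le l n

/-- Abel summation: multiplication by `1 - z` replaces the coefficients by their successive
differences, and the differences of a harmonic sum are its summands. For empty `l` this is the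
geometric series. -/
theorem polylogSeries_deriv_one_mul {l : List ℕ} {z : ℂ} (hz : ‖z‖ < 1) :
    (1 - z) * (∑' n : ℕ, z ^ n * (((n : ℂ) + 1) * harmonicSum l n / ((n : ℂ) + 1) ^ 1)) =
      polylogSeries l z := by
  have e : ∀ n : ℕ, z ^ n * (((n : ℂ) + 1) * harmonicSum l n / ((n : ℂ) + 1) ^ 1)
      = z ^ n * harmonicSum l n := fun n => by
    have : ((n : ℂ) + 1) ≠ 0 := Nat.cast_add_one_ne_zero n
    field_simp
  simp_rw [e]
  have hs := summable_pow_mul_harmonicSum l hz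
  cases l with
  | nil => simpa [harmonicSum, polylogSeries, tsum_geometric_of_norm_lt_one hz] using
      mul_inv_cancel₀ (sub_ne_zero.2 (by rintro rfl; simp at hz))
  | cons s l =>
    have hs1 := (summable_nat_add_iff 1).2 hs
    rw [sub_mul, one_mul, ← tsum_mul_left, hs.tsum_eq_zero_add]
    -- The constant term drops because `harmonicSum (s :: l) 0` is an empty sum.
    conv_lhs => enter [1, 1]; simp [harmonicSum]
    rw [zero_add, ← hs1.tsum_sub (hs.mul_left z), polylogSeries]
    refine tsum_congr fun n => ?_
    simp only [harmonicSum, Finset.sum_range_succ]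
    ring

/-! ### Analytic continuation of the power series -/

theorem eqOn_ball_of_hasDerivAt {F G f g : ℂ → ℂ}
    (hF : ∀ z, ‖z‖ < 1 → HasDerivAt F (f z) z) (hG : ∀ z, ‖z‖ < 1 → HasDerivAt G (g z) z)
    (hfg : ∀ z, ‖z‖ < 1 → f z = g z) (h0 : F 0 = G 0) {z : ℂ} (hz : ‖z‖ < 1) : F z = G z := by
  have hb : ∀ z ∈ Metric.ball (0 : ℂ) 1, ‖z‖ < 1 := fun z hz => by simpa using hz
  refine Metric.isOpen_ball.eqOn_of_deriv_eq (convex_ball (0 : ℂ) 1).isPreconnected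
    (fun w hw => (hF w (hb w hw)).differentiableAt.differentiableWithinAt)
    (fun w hw => (hG w (hb w hw)).differentiableAt.differentiableWithinAt)
    (fun w hw => ?_) (Metric.mem_ball_self one_pos) h0 (by simpa using hz)
  rw [(hF w (hb w hw)).deriv, (hG w (hb w hw)).deriv, hfg w (hb w hw)]

/-- Induction on the list and, inside it, on its first part: a part `1` arises by integrating
against `dz/(1-z)`, and raising a part by one is integration against `dz/z`. -/
theorem exists_continuation (l : List ℕ) (hl : ∀ s ∈ l, 1 ≤ s) :
    ∃ F : ℂ → ℂ, DifferentiableOn ℂ F cutPlane ∧ ∀ z, ‖z‖ < 1 → F z = polylogSeries l z := by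
  induction l with
  | nil => exact ⟨fun _ => 1, differentiableOn_const _, fun z _ => rfl⟩
  | cons s l ih =>
    have hs : 1 ≤ s := hl s (by simp)
    induction s, hs using Nat.le_induction with
    | base =>
      obtain ⟨F, hF, hFs⟩ := ih fun s hs => hl s (by simp [hs])
      obtain ⟨G, hG0, hG⟩ := exists_primitive_cutPlane (f := fun z => F z / (1 - z))
        (hF.div (by fun_prop) fun z hz => Complex.slitPlane_ne_zero hz)
      refine ⟨G, fun z hz => (hG z hz).differentiableAt.differentiableWithinAt, fun z hz =>
        eqOn_ball_of_hasDerivAt (fun z hz => hG z (ball_subset_cutPlane (by simpa using hz)))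
          (fun z hz => hasDerivAt_polylogSeries 1 l hz) (fun z hz => ?_)
          (by rw [hG0, polylogSeries_zero]) hz⟩
      have h1 : 1 - z ≠ 0 := sub_ne_zero.2 (by rintro rfl; simp at hz)
      rw [hFs z hz, ← polylogSeries_deriv_one_mul hz]
      field_simp
    | succ s hs ihs =>
      obtain ⟨F, hF, hFs⟩ := ihs (by
        intro t ht
        rcases List.mem_cons.1 ht with rfl | ht
        · exact hs
        · exact hl t (by simp [ht]))
      -- Since `F 0 = 0`, `dslope F 0` is `F(z)/z` with its removable singularity at `0` filled in.
      obtain ⟨G, hG0, hG⟩ := exists_primitive_cutPlane (f := dslope F 0)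
        ((Complex.differentiableOn_dslope (isOpen_cutPlane.mem_nhds zero_mem_cutPlane)).2 hF)
      refine ⟨G, fun z hz => (hG z hz).differentiableAt.differentiableWithinAt, fun z hz =>
        eqOn_ball_of_hasDerivAt (fun z hz => hG z (ball_subset_cutPlane (by simpa using hz)))
          (fun z hz => hasDerivAt_polylogSeries (s + 1) l hz) (fun z hz => ?_)
          (by rw [hG0, polylogSeries_zero]) hz⟩
      have hF0 : F 0 = 0 := by rw [hFs 0 (by simp), polylogSeries_zero]
      by_cases h0 : z = 0
      · subst h0
        have hd : HasDerivAt F _ 0 := (hasDerivAt_polylogSeries s l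
          (z := 0) (by simp)).congr_of_eventuallyEq (by
            filter_upwards [Metric.ball_mem_nhds (0 : ℂ) one_pos] with w hw
            exact hFs w (by simpa using hw))
        rw [dslope_same, hd.deriv]
        -- At `z = 0` only the term `n = 0` survives, and there the exponents `s` and `s + 1` give
        -- the same value.
        refine tsum_congr fun n => ?_
        cases n <;> simp
      · rw [dslope_of_ne _ h0, slope_def_field, hF0, hFs z hz, ← polylogSeries_deriv_mul]
        rw [sub_zero, sub_zero, mul_div_cancel_left₀ _ h0]

theorem eqOn_cleftPlane {F G : ℂ → ℂ} (hF : DifferentiableOn ℂ F cleftPlane)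
    (hG : DifferentiableOn ℂ G cleftPlane)
    (h : ∀ z ∈ cleftPlane, ‖z‖ < 1 → F z = G z) : Set.EqOn F G cleftPlane := by
  have hm : ((1 / 2 : ℝ) : ℂ) ∈ cleftPlane := ofReal_mem_cleftPlane (by norm_num) (by norm_num)
  refine (hF.analyticOnNhd isOpen_cleftPlane).eqOn_of_preconnected_of_eventuallyEq
    (hG.analyticOnNhd isOpen_cleftPlane) isPreconnected_cleftPlane hm ?_
  filter_upwards [isOpen_cleftPlane.mem_nhds hm,
    Metric.isOpen_ball.mem_nhds (show ((1 / 2 : ℝ) : ℂ) ∈ Metric.ball (0 : ℂ) 1 by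
      simp; norm_num)] with z hz hb
  exact h z hz (by simpa using hb)

theorem polylogCont_eq {l : List ℕ} {F : ℂ → ℂ} (hF : DifferentiableOn ℂ F cutPlane)
    (hFs : ∀ z, ‖z‖ < 1 → F z = polylogSeries l z) (z : cleftPlane) : polylogCont l z = F z := by
  have h : ∃ F : ℂ → ℂ, DifferentiableOn ℂ F cleftPlane ∧
      ∀ z ∈ cleftPlane, ‖z‖ < 1 → F z = polylogSeries l z :=
    ⟨F, hF.mono cleftPlane_subset_cutPlane, fun z _ => hFs z⟩
  rw [polylogCont, dif_pos h]
  exact eqOn_cleftPlane h.choose_spec.1 (hF.mono cleftPlane_subset_cutPlane)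
    (fun z hz hb => by rw [h.choose_spec.2 z hz hb, hFs z hb]) z.2

/-! ### Derivatives of functions on the cleft plane -/

theorem extendCleft_apply (f : CleftFun) (z : cleftPlane) : extendCleft f z = f z := by
  simp [extendCleft]

theorem extendCleft_of_mem (f : CleftFun) {z : ℂ} (hz : z ∈ cleftPlane) :
    extendCleft f z = f ⟨z, hz⟩ := extendCleft_apply f ⟨z, hz⟩

theorem extendCleft_add (f g : CleftFun) : extendCleft (f + g) = extendCleft f + extendCleft g := by
  ext z
  by_cases hz : z ∈ cleftPlane <;> simp [extendCleft, hz]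

theorem extendCleft_smul (c : ℂ) (f : CleftFun) : extendCleft (c • f) = c • extendCleft f := by
  ext z
  by_cases hz : z ∈ cleftPlane <;> simp [extendCleft, hz]

theorem extendCleft_mul (f g : CleftFun) : extendCleft (f * g) = extendCleft f * extendCleft g := by
  ext z
  by_cases hz : z ∈ cleftPlane <;> simp [extendCleft, hz]

theorem extendCleft_zero : extendCleft 0 = 0 := by
  ext z
  by_cases hz : z ∈ cleftPlane <;> simp [extendCleft, hz]

theorem extendCleft_restrict_eventuallyEq (F : ℂ → ℂ) {z : ℂ} (hz : z ∈ cleftPlane) :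
    extendCleft (fun w => F w) =ᶠ[𝓝 z] F := by
  filter_upwards [isOpen_cleftPlane.mem_nhds hz] with w hw
  rw [extendCleft_of_mem _ hw]

/-- `F` is a primitive of `f` on the cleft plane. -/
def HasCleftDeriv (F f : CleftFun) : Prop := ∀ z : cleftPlane, HasDerivAt (extendCleft F) (f z) z

namespace HasCleftDeriv

theorem of_hasDerivAt {F f : ℂ → ℂ} (h : ∀ z ∈ cleftPlane, HasDerivAt F (f z) z) :
    HasCleftDeriv (fun z => F z) fun z => f z := fun z =>
  (h z z.2).congr_of_eventuallyEq (extendCleft_restrict_eventuallyEq F z.2)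

theorem zero : HasCleftDeriv 0 0 := fun z => by
  rw [extendCleft_zero]
  exact hasDerivAt_const _ _

theorem one : HasCleftDeriv 1 0 :=
  of_hasDerivAt (F := fun _ => 1) (f := fun _ => 0) fun _ _ => hasDerivAt_const _ _

theorem add {F f G g : CleftFun} (hF : HasCleftDeriv F f) (hG : HasCleftDeriv G g) :
    HasCleftDeriv (F + G) (f + g) := fun z => by
  rw [extendCleft_add]
  exact (hF z).add (hG z)

theorem smul (c : ℂ) {F f : CleftFun} (hF : HasCleftDeriv F f) :
    HasCleftDeriv (c • F) (c • f) := fun z => by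
  rw [extendCleft_smul]
  exact (hF z).const_smul c

theorem sub {F f G g : CleftFun} (hF : HasCleftDeriv F f) (hG : HasCleftDeriv G g) :
    HasCleftDeriv (F - G) (f - g) := by
  have := hF.add (hG.smul (-1))
  simpa [sub_eq_add_neg] using this

theorem mul {F f G g : CleftFun} (hF : HasCleftDeriv F f) (hG : HasCleftDeriv G g) :
    HasCleftDeriv (F * G) (f * G + F * g) := fun z => by
  rw [extendCleft_mul]
  simpa [extendCleft_apply] using (hF z).mul (hG z)

theorem sum {ι : Type*} (s : Finset ι) {F f : ι → CleftFun}
    (h : ∀ i ∈ s, HasCleftDeriv (F i) (f i)) : HasCleftDeriv (∑ i ∈ s, F i) (∑ i ∈ s, f i) := by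
  classical
  induction s using Finset.induction_on with
  | empty => simpa using zero
  | insert a s ha ih =>
    rw [Finset.sum_insert ha, Finset.sum_insert ha]
    exact (h a (by simp)).add (ih fun i hi => h i (by simp [hi]))

theorem pow {F f : CleftFun} (hF : HasCleftDeriv F f) (n : ℕ) :
    HasCleftDeriv (F ^ (n + 1)) (((n : ℂ) + 1) • (F ^ n * f)) := by
  induction n with
  | zero => simpa using hF
  | succ n ih =>
    have h := ih.mul hF
    rw [pow_succ F (n + 1)]
    refine cast ?_ h
    congr 1
    ext z
    simp
    ring

theorem continuousAt {F f : CleftFun} (hF : HasCleftDeriv F f) {z : ℂ} (hz : z ∈ cleftPlane) :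
    ContinuousAt (extendCleft F) z := (hF ⟨z, hz⟩).continuousAt

theorem continuous {F f : CleftFun} (hF : HasCleftDeriv F f) : Continuous F := by
  have : F = fun z : cleftPlane => extendCleft F z := by
    ext z; rw [extendCleft_apply]
  rw [this, continuous_iff_continuousAt]
  exact fun z => (hF.continuousAt z.2).comp continuous_subtype_val.continuousAt

theorem exists_eq_const {F : CleftFun} (hF : HasCleftDeriv F 0) : ∃ c : ℂ, ∀ z, F z = c := by
  have hm : ((1 / 2 : ℝ) : ℂ) ∈ cleftPlane := ofReal_mem_cleftPlane (by norm_num) (by norm_num)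
  refine ⟨F ⟨_, hm⟩, fun z => ?_⟩
  have := isOpen_cleftPlane.eqOn_of_deriv_eq (f := extendCleft F)
    (g := fun _ => F ⟨_, hm⟩) isPreconnected_cleftPlane
    (fun w hw => (hF ⟨w, hw⟩).differentiableAt.differentiableWithinAt)
    (differentiableOn_const _) (fun w hw => by rw [(hF ⟨w, hw⟩).deriv]; simp) hm
    (extendCleft_of_mem _ hm)
  simpa [extendCleft_apply] using this z.2

end HasCleftDeriv

/-- The differential forms `ω₀ = dz / z` and `ω₁ = dz / (1 - z)`. -/
def cleftForm (i : Fin 2) : CleftFun := fun z => if i = 0 then (z : ℂ)⁻¹ else (1 - (z : ℂ))⁻¹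

theorem hasCleftDeriv_cleftLog : HasCleftDeriv cleftLog (cleftForm 0) :=
  HasCleftDeriv.of_hasDerivAt (F := Complex.log) (f := fun z => z⁻¹) fun _ hz =>
    Complex.hasDerivAt_log (mem_cleftPlane_iff.1 hz).1

/-- The relation `(1 - z) G' = F` holds on the unit disc by the power series, and propagates to `Ω`
by the identity theorem. -/
theorem hasCleftDeriv_polylogCont_one {l : List ℕ} (hl : ∀ s ∈ l, 1 ≤ s) :
    HasCleftDeriv (polylogCont (1 :: l)) (cleftForm 1 * polylogCont l) := by
  obtain ⟨F, hF, hFs⟩ := exists_continuation l hl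
  obtain ⟨G, hG, hGs⟩ := exists_continuation (1 :: l) (by simpa using hl)
  have hG' : DifferentiableOn ℂ (deriv G) cutPlane := hG.deriv isOpen_cutPlane
  have key : Set.EqOn (fun z => (1 - z) * deriv G z) F cleftPlane := by
    refine eqOn_cleftPlane (((differentiableOn_const _).sub differentiableOn_id).mul
      (hG'.mono cleftPlane_subset_cutPlane)) (hF.mono cleftPlane_subset_cutPlane) fun z _ hb => ?_
    have hd : HasDerivAt G _ z := (hasDerivAt_polylogSeries 1 l hb).congr_of_eventuallyEq (by
      filter_upwards [Metric.isOpen_ball.mem_nhds (show z ∈ Metric.ball (0 : ℂ) 1 by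
        simpa using hb)] with w hw
      exact hGs w (by simpa using hw))
    rw [hd.deriv, hFs z hb, polylogSeries_deriv_one_mul hb]
  have e : polylogCont (1 :: l) = fun z : cleftPlane => G z := funext (polylogCont_eq hG hGs)
  rw [e]
  have := HasCleftDeriv.of_hasDerivAt (F := G) (f := deriv G) fun z hz =>
    (hG.differentiableAt (isOpen_cutPlane.mem_nhds (cleftPlane_subset_cutPlane hz))).hasDerivAt
  refine cast ?_ this
  congr 1
  ext z
  have h1 := one_sub_cleftPlane_ne_zero z.2
  have h2 := key z.2
  simp only [Pi.mul_apply, cleftForm, polylogCont_eq hF hFs, ← h2]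
  simp [h1]

theorem hasCleftDeriv_polylogCont_succ {s : ℕ} {l : List ℕ} (hs : 1 ≤ s) (hl : ∀ s ∈ l, 1 ≤ s) :
    HasCleftDeriv (polylogCont ((s + 1) :: l)) (cleftForm 0 * polylogCont (s :: l)) := by
  obtain ⟨F, hF, hFs⟩ := exists_continuation (s :: l) (by simpa [hs] using hl)
  obtain ⟨G, hG, hGs⟩ := exists_continuation ((s + 1) :: l) (by simpa using hl)
  have hG' : DifferentiableOn ℂ (deriv G) cutPlane := hG.deriv isOpen_cutPlane
  have key : Set.EqOn (fun z => z * deriv G z) F cleftPlane := by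
    refine eqOn_cleftPlane (differentiableOn_id.mul
      (hG'.mono cleftPlane_subset_cutPlane)) (hF.mono cleftPlane_subset_cutPlane) fun z _ hb => ?_
    have hd : HasDerivAt G _ z := (hasDerivAt_polylogSeries (s + 1) l hb).congr_of_eventuallyEq (by
      filter_upwards [Metric.isOpen_ball.mem_nhds (show z ∈ Metric.ball (0 : ℂ) 1 by
        simpa using hb)] with w hw
      exact hGs w (by simpa using hw))
    rw [hd.deriv, hFs z hb, polylogSeries_deriv_mul]
  have e : polylogCont ((s + 1) :: l) = fun z : cleftPlane => G z := funext (polylogCont_eq hG hGs)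
  rw [e]
  have := HasCleftDeriv.of_hasDerivAt (F := G) (f := deriv G) fun z hz =>
    (hG.differentiableAt (isOpen_cutPlane.mem_nhds (cleftPlane_subset_cutPlane hz))).hasDerivAt
  refine cast ?_ this
  congr 1
  ext z
  have h1 := cleftPlane_ne_zero z.2
  have h2 := key z.2
  simp only [Pi.mul_apply, cleftForm, polylogCont_eq hF hFs, ← h2]
  simp [h1]

theorem polylogCont_nil : polylogCont [] = 1 := funext fun z =>
  polylogCont_eq (F := fun _ => 1) (differentiableOn_const _) (fun _ _ => rfl) z

/-! ### Behaviour at the origin -/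

theorem eventually_mem_cleftPlane : ∀ᶠ ε : ℝ in 𝓝[>] 0, (ε : ℂ) ∈ cleftPlane := by
  filter_upwards [Ioo_mem_nhdsGT (zero_lt_one' ℝ)] with ε hε
  exact ofReal_mem_cleftPlane hε.1 hε.2

/-- `f(ε) log(ε)^m` tends to `0` as `ε → 0⁺` for every `m`. -/
def VanishesAtZero (f : CleftFun) : Prop :=
  ∀ m : ℕ, Tendsto (fun ε : ℝ => extendCleft f ε * (Real.log ε : ℂ) ^ m) (𝓝[>] 0) (𝓝 0)

namespace VanishesAtZero

theorem zero : VanishesAtZero 0 := fun m => by simp [extendCleft_zero]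

theorem add {f g : CleftFun} (hf : VanishesAtZero f) (hg : VanishesAtZero g) :
    VanishesAtZero (f + g) := fun m => by
  simpa [extendCleft_add, add_mul] using (hf m).add (hg m)

theorem smul (c : ℂ) {f : CleftFun} (hf : VanishesAtZero f) : VanishesAtZero (c • f) := fun m => by
  simpa [extendCleft_smul, mul_assoc] using (hf m).const_mul c

theorem sub {f g : CleftFun} (hf : VanishesAtZero f) (hg : VanishesAtZero g) :
    VanishesAtZero (f - g) := by
  have := hf.add (hg.smul (-1))
  simpa [sub_eq_add_neg] using this

theorem mul {f g : CleftFun} (hf : VanishesAtZero f) (hg : VanishesAtZero g) :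
    VanishesAtZero (f * g) := fun m => by
  have := (hf m).mul (hg 0)
  simp only [pow_zero, mul_one, mul_zero] at this
  refine this.congr fun ε => ?_
  rw [extendCleft_mul, Pi.mul_apply]
  ring

/-- This stability is the reason why `VanishesAtZero` asks for decay against every power of `log`.
-/
theorem mul_cleftLog {f : CleftFun} (hf : VanishesAtZero f) : VanishesAtZero (f * cleftLog) :=
    fun m => by
  refine (hf (m + 1)).congr' ?_
  filter_upwards [eventually_mem_cleftPlane, self_mem_nhdsWithin] with ε hε h0
  rw [extendCleft_mul, Pi.mul_apply, extendCleft_of_mem cleftLog hε, cleftLog,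
    Complex.ofReal_log (Set.mem_Ioi.1 h0).le]
  ring

theorem mul_cleftLog_pow {f : CleftFun} (hf : VanishesAtZero f) (n : ℕ) :
    VanishesAtZero (f * cleftLog ^ n) := by
  induction n with
  | zero => simpa using hf
  | succ n ih => simpa [pow_succ, mul_assoc] using ih.mul_cleftLog

theorem sum {ι : Type*} (s : Finset ι) {f : ι → CleftFun} (h : ∀ i ∈ s, VanishesAtZero (f i)) :
    VanishesAtZero (∑ i ∈ s, f i) := by
  classical
  induction s using Finset.induction_on with
  | empty => simpa using zero
  | insert a s ha ih =>
    rw [Finset.sum_insert ha]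
    exact (h a (by simp)).add (ih fun i hi => h i (by simp [hi]))

theorem tendsto {f : CleftFun} (h : VanishesAtZero f) :
    Tendsto (fun ε : ℝ => extendCleft f ε) (𝓝[>] 0) (𝓝 0) := by simpa using h 0

/-- `F(ε) = O(ε)`, and `ε log^m ε → 0`, as the substitution `x = -log ε` shows. -/
theorem of_differentiableAt {F : ℂ → ℂ} (hF : DifferentiableAt ℂ F 0) (h0 : F 0 = 0) :
    VanishesAtZero fun z => F z := fun m => by
  have hb : (fun z => F z) =O[𝓝 0] fun z : ℂ => z := by
    simpa [h0] using hF.isBigO_sub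
  have ht : Tendsto (fun ε : ℝ => (ε : ℂ)) (𝓝[>] 0) (𝓝 0) :=
    (Complex.continuous_ofReal.tendsto' 0 0 (by simp)).mono_left nhdsWithin_le_nhds
  have h1 : (fun ε : ℝ => F ε * (Real.log ε : ℂ) ^ m) =O[𝓝[>] 0]
      fun ε : ℝ => (ε : ℂ) * (Real.log ε : ℂ) ^ m :=
    (hb.comp_tendsto ht).mul (Asymptotics.isBigO_refl _ _)
  have h2 : Tendsto (fun ε : ℝ => ε * Real.log ε ^ m) (𝓝[>] 0) (𝓝 0) := by
    have hx := (Real.tendsto_pow_mul_exp_neg_atTop_nhds_zero m).const_mul ((-1) ^ m)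
    rw [mul_zero] at hx
    have hl : Tendsto (fun ε : ℝ => -Real.log ε) (𝓝[>] 0) atTop :=
      tendsto_neg_atBot_atTop.comp Real.tendsto_log_nhdsGT_zero
    refine (hx.comp hl).congr' ?_
    filter_upwards [self_mem_nhdsWithin] with ε hε
    simp only [Function.comp_apply, neg_neg, Real.exp_log (Set.mem_Ioi.1 hε)]
    rw [← mul_assoc, ← mul_pow]
    simp [mul_comm]
  have h3 := (Complex.continuous_ofReal.tendsto' 0 0 (by simp)).comp h2
  have h4 := h1.trans_tendsto (h3.congr fun ε => by simp)
  refine h4.congr' ?_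
  filter_upwards [eventually_mem_cleftPlane] with ε hε
  rw [extendCleft_of_mem _ hε]

theorem polylogCont {s : ℕ} {l : List ℕ} (hl : ∀ t ∈ s :: l, 1 ≤ t) :
    VanishesAtZero (polylogCont (s :: l)) := by
  obtain ⟨F, hF, hFs⟩ := exists_continuation (s :: l) hl
  have e : _root_.polylogCont (s :: l) = fun z : cleftPlane => F z := funext (polylogCont_eq hF hFs)
  rw [e]
  exact of_differentiableAt (hF.differentiableAt (isOpen_cutPlane.mem_nhds zero_mem_cutPlane))
    (by rw [hFs 0 (by simp), polylogSeries_zero])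

end VanishesAtZero

/-- A function with derivative `0` of the form `κ log^(n+1) + o(1)` at the origin vanishes. -/
theorem eq_zero_of_hasCleftDeriv_zero {F : CleftFun} (hF : HasCleftDeriv F 0) {κ : ℂ} {n : ℕ}
    (h : VanishesAtZero (F - κ • cleftLog ^ (n + 1))) : F = 0 := by
  obtain ⟨c, hc⟩ := hF.exists_eq_const
  have h1 : Tendsto (fun ε : ℝ => c - κ * (Real.log ε : ℂ) ^ (n + 1)) (𝓝[>] 0) (𝓝 0) := by
    refine h.tendsto.congr' ?_
    filter_upwards [eventually_mem_cleftPlane, self_mem_nhdsWithin] with ε hε h0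
    rw [extendCleft_of_mem _ hε]
    simp [hc, cleftLog, Complex.ofReal_log (Set.mem_Ioi.1 h0).le]
  have hl : Tendsto (fun ε : ℝ => ‖(Real.log ε : ℂ) ^ (n + 1)‖) (𝓝[>] 0) atTop := by
    have : Tendsto (fun ε : ℝ => |Real.log ε| ^ (n + 1)) (𝓝[>] 0) atTop :=
      (tendsto_pow_atTop n.succ_ne_zero).comp
        (tendsto_abs_atBot_atTop.comp Real.tendsto_log_nhdsGT_zero)
    simpa using this
  -- `κ log^(n+1)` tends to the constant value `c` of `F`, but is unbounded unless `κ = 0`. Then `c`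
  -- is the limit `0`.
  have hκ : κ = 0 := by
    by_contra hne
    have h2 : Tendsto (fun ε : ℝ => κ * (Real.log ε : ℂ) ^ (n + 1)) (𝓝[>] 0) (𝓝 c) := by
      simpa using (tendsto_const_nhds (x := c)).sub h1
    have h3 : Tendsto (fun ε : ℝ => ‖κ * (Real.log ε : ℂ) ^ (n + 1)‖) (𝓝[>] 0) atTop := by
      simp only [norm_mul]
      exact hl.const_mul_atTop (norm_pos_iff.2 hne)
    exact not_tendsto_nhds_of_tendsto_atTop h3 _ h2.norm
  subst hκ
  simp only [zero_mul, sub_zero] at h1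
  have := tendsto_nhds_unique h1 tendsto_const_nhds
  ext z
  simp [hc, ← this]

/-! ### The differential system of the polylogarithms -/

/-- A word ending in `x₁` has a nonempty composition, and the running argument `s` enters only its
first part. -/
theorem exists_compositionOf_append_one (u : XWord) :
    ∃ t l, (∀ r ∈ l, 1 ≤ r) ∧ ∀ s, compositionOf s (u ++ [1]) = (s + t) :: l := by
  induction u with
  | nil => exact ⟨0, [], by simp, fun s => by simp [compositionOf]⟩
  | cons i u ih =>
    obtain ⟨t, l, hl, h⟩ := ih
    by_cases hi : i = 0
    · refine ⟨t + 1, l, hl, fun s => ?_⟩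
      rw [List.cons_append, compositionOf, if_pos hi, h, add_right_comm, add_assoc]
    · refine ⟨0, (1 + t) :: l, ?_, fun s => ?_⟩
      · intro r hr
        rcases List.mem_cons.1 hr with rfl | hr
        · omega
        · exact hl r hr
      · rw [List.cons_append, compositionOf, if_neg hi, h, add_zero]

theorem fin_two_eq_one {i : Fin 2} (h : i ≠ 0) : i = 1 := by omega

theorem hasCleftDeriv_polylogAux_cons_zero (i : Fin 2) (u : XWord) :
    HasCleftDeriv (polylogAux (i :: u) 0) (cleftForm i * polylogAux u 0) := by
  obtain ⟨t, l, hl, h⟩ := exists_compositionOf_append_one u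
  rw [polylogAux, polylogAux, List.cons_append, compositionOf]
  by_cases hi : i = 0
  · rw [if_pos hi, h, h, hi, add_right_comm]
    exact hasCleftDeriv_polylogCont_succ (by omega) hl
  · rw [if_neg hi, fin_two_eq_one hi, h]
    refine hasCleftDeriv_polylogCont_one fun r hr => ?_
    rcases List.mem_cons.1 hr with rfl | hr
    · omega
    · exact hl r hr

theorem cast_add_one_ne_zero (n : ℕ) : (n : ℂ) + 1 ≠ 0 := Nat.cast_add_one_ne_zero n

theorem polylogAux_succ_smul (u : XWord) (n : ℕ) :
    ((n : ℂ) + 1) • polylogAux u (n + 1) = polylogAux u n * cleftLog -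
      ∑ i ∈ Finset.range (u.length + 1), polylogAux (u.insertIdx i 0) n := by
  rw [polylogAux, smul_inv_smul₀ (cast_add_one_ne_zero n)]

theorem hasCleftDeriv_log_pow (n : ℕ) :
    HasCleftDeriv (((n + 1).factorial : ℂ)⁻¹ • cleftLog ^ (n + 1))
      (cleftForm 0 * ((n.factorial : ℂ)⁻¹ • cleftLog ^ n)) := by
  refine cast ?_ ((hasCleftDeriv_cleftLog.pow n).smul (((n + 1).factorial : ℂ)⁻¹))
  congr 1
  ext z
  have h1 := cast_add_one_ne_zero n
  have h2 : (n.factorial : ℂ) ≠ 0 := by exact_mod_cast n.factorial_ne_zero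
  simp only [Pi.smul_apply, Pi.mul_apply, Pi.pow_apply, smul_eq_mul, Nat.factorial_succ]
  push_cast
  field_simp

/-- Both statements are proved together: for the empty `u` at `n + 1`, the recursion involves
`polylogAux [0] n`, whose derivative comes from the second statement. -/
theorem hasCleftDeriv_polylogAux_nil (n : ℕ) :
    HasCleftDeriv (polylogAux [] n) (cleftForm 1 * ((n.factorial : ℂ)⁻¹ • cleftLog ^ n)) ∧
    ∀ i u, HasCleftDeriv (polylogAux (i :: u) n) (cleftForm i * polylogAux u n) := by
  induction n with
  | zero =>
    refine ⟨?_, fun i u => hasCleftDeriv_polylogAux_cons_zero i u⟩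
    have h := hasCleftDeriv_polylogCont_one (l := []) (by simp)
    rw [polylogCont_nil] at h
    simpa [polylogAux, compositionOf] using h
  | succ n ih =>
    have hn := cast_add_one_ne_zero n
    constructor
    · have h := ((ih.1.mul hasCleftDeriv_cleftLog).sub (ih.2 0 [])).smul ((n : ℂ) + 1)⁻¹
      have e : polylogAux [] (n + 1) = ((n : ℂ) + 1)⁻¹ • (polylogAux [] n * cleftLog -
        polylogAux [0] n) := by simp [polylogAux]
      rw [e]
      refine cast ?_ h
      congr 1
      ext z
      have h2 : (n.factorial : ℂ) ≠ 0 := by exact_mod_cast n.factorial_ne_zero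
      simp only [Pi.smul_apply, Pi.mul_apply, Pi.pow_apply, Pi.add_apply, Pi.sub_apply,
        smul_eq_mul, Nat.factorial_succ]
      push_cast
      field_simp
      ring
    · intro i u
      -- The insertion of `x₀` in front (`k = 0`) contributes `ω₀ Li_{i u x₁ x₀^n}`, which cancels
      -- the term from differentiating `log`. The other insertions are insertions in `u`, at `k -
      -- 1`, and rebuild the recursion for `u`.
      have h := (((ih.2 i u).mul hasCleftDeriv_cleftLog).sub
        (HasCleftDeriv.sum (Finset.range ((i :: u).length + 1))
          (F := fun k => polylogAux ((i :: u).insertIdx k 0) n)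
          (f := fun k => if k = 0 then cleftForm 0 * polylogAux (i :: u) n
            else cleftForm i * polylogAux (u.insertIdx (k - 1) 0) n) fun k hk => by
              cases k with
              | zero => simpa using ih.2 0 (i :: u)
              | succ k => simpa using ih.2 i (u.insertIdx k 0))).smul ((n : ℂ) + 1)⁻¹
      rw [polylogAux]
      refine cast ?_ h
      congr 1
      rw [inv_smul_eq_iff₀ hn, ← mul_smul_comm, polylogAux_succ_smul, List.length_cons,
        Finset.sum_range_succ']
      simp only [Nat.add_eq_zero_iff, one_ne_zero, and_false, if_false, Nat.add_sub_cancel, if_true,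
        ← Finset.mul_sum]
      ring

theorem vanishesAtZero_polylogAux (u : XWord) (n : ℕ) : VanishesAtZero (polylogAux u n) := by
  induction n generalizing u with
  | zero =>
    obtain ⟨t, l, hl, h⟩ := exists_compositionOf_append_one u
    rw [polylogAux, h]
    refine VanishesAtZero.polylogCont fun r hr => ?_
    rcases List.mem_cons.1 hr with rfl | hr
    · omega
    · exact hl r hr
  | succ n ih =>
    rw [polylogAux]
    exact ((ih u).mul_cleftLog.sub (VanishesAtZero.sum _ fun i _ => ih _)).smul _

theorem polylog_replicate_zero (n : ℕ) :
    polylog (List.replicate n 0) = (n.factorial : ℂ)⁻¹ • cleftLog ^ n := by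
  have h1 : (List.replicate n (0 : Fin 2)).takeWhile (· = 0) = List.replicate n 0 := by
    simp
  have h2 : (List.replicate n (0 : Fin 2)).dropWhile (· = 0) = [] := by
    simp
  simp only [polylog, List.reverse_replicate, h1, h2, List.length_replicate]

theorem polylog_append_one (u : XWord) (n : ℕ) :
    polylog (u ++ 1 :: List.replicate n 0) = polylogAux u n := by
  have e : (u ++ 1 :: List.replicate n 0).reverse = List.replicate n 0 ++ 1 :: u.reverse := by
    simp
  have h1 : (List.replicate n (0 : Fin 2) ++ 1 :: u.reverse).takeWhile (· = 0) =
      List.replicate n 0 := by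
    rw [List.takeWhile_append_of_pos (by simp)]
    simp
  have h2 : (List.replicate n (0 : Fin 2) ++ 1 :: u.reverse).dropWhile (· = 0) =
      1 :: u.reverse := by
    rw [List.dropWhile_append_of_pos (by simp)]
    simp
  simp only [polylog, e, h1, h2, List.length_replicate, List.reverse_reverse]

theorem word_cases (w : XWord) :
    (∃ n, w = List.replicate n 0) ∨ ∃ u n, w = u ++ 1 :: List.replicate n 0 := by
  induction w with
  | nil => exact Or.inl ⟨0, rfl⟩
  | cons i w ih =>
    rcases ih with ⟨n, rfl⟩ | ⟨u, n, rfl⟩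
    · by_cases hi : i = 0
      · exact Or.inl ⟨n + 1, by rw [hi, List.replicate_succ]⟩
      · exact Or.inr ⟨[], n, by rw [fin_two_eq_one hi, List.nil_append]⟩
    · exact Or.inr ⟨i :: u, n, rfl⟩

theorem polylog_nil : polylog [] = 1 := by
  have := polylog_replicate_zero 0
  simpa using this

theorem hasCleftDeriv_polylog_cons (i : Fin 2) (w : XWord) :
    HasCleftDeriv (polylog (i :: w)) (cleftForm i * polylog w) := by
  rcases word_cases w with ⟨n, rfl⟩ | ⟨u, n, rfl⟩
  · by_cases hi : i = 0
    · rw [hi, ← List.replicate_succ, polylog_replicate_zero, polylog_replicate_zero]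
      exact hasCleftDeriv_log_pow n
    · have := (hasCleftDeriv_polylogAux_nil n).1
      rw [← polylog_append_one, ← polylog_replicate_zero, List.nil_append] at this
      rwa [fin_two_eq_one hi]
  · have := (hasCleftDeriv_polylogAux_nil n).2 i u
    rw [← polylog_append_one, ← polylog_append_one] at this
    exact this

theorem vanishesAtZero_polylog {w : XWord} (h : 1 ∈ w) : VanishesAtZero (polylog w) := by
  rcases word_cases w with ⟨n, rfl⟩ | ⟨u, n, rfl⟩
  · simp at h
  · rw [polylog_append_one]
    exact vanishesAtZero_polylogAux u n

/-! ### Compatibility with the shuffle product -/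

/-- `∑_{|w| = n} ⟨T | w⟩ Li_w`. -/
def polylogHom (T : NCSeries) (n : ℕ) : CleftFun :=
  ∑ v : Fin n → Fin 2, T.coeff (List.ofFn v) • polylog (List.ofFn v)

theorem polylogHom_zero (T : NCSeries) : polylogHom T 0 = T.coeff [] • 1 := by
  simp [polylogHom, polylog_nil]

theorem polylogHom_add (S T : NCSeries) (n : ℕ) :
    polylogHom (S + T) n = polylogHom S n + polylogHom T n := by
  simp [polylogHom, add_smul, Finset.sum_add_distrib]

theorem polylogHom_smul (c : ℂ) (T : NCSeries) (n : ℕ) :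
    polylogHom (c • T) n = c • polylogHom T n := by
  simp [polylogHom, mul_smul, Finset.smul_sum]

theorem sum_fin_succ_fin_two {M : Type*} [AddCommMonoid M] (n : ℕ)
    (g : (Fin (n + 1) → Fin 2) → M) :
    ∑ v, g v = ∑ i : Fin 2, ∑ v : Fin n → Fin 2, g (Fin.cons i v) := by
  rw [← Fintype.sum_prod_type', ← (Fin.consEquiv fun _ : Fin (n + 1) => Fin 2).sum_comp]
  rfl

theorem hasCleftDeriv_polylogHom (T : NCSeries) (n : ℕ) :
    HasCleftDeriv (polylogHom T (n + 1))
      (∑ i : Fin 2, cleftForm i * polylogHom (T.residual i) n) := by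
  rw [polylogHom, sum_fin_succ_fin_two]
  refine HasCleftDeriv.sum _ fun i _ => ?_
  rw [polylogHom, Finset.mul_sum]
  refine HasCleftDeriv.sum _ fun v _ => ?_
  rw [mul_smul_comm, List.ofFn_cons]
  exact (hasCleftDeriv_polylog_cons i _).smul _

theorem exists_ofFn_one_mem {n : ℕ} {v : Fin n → Fin 2} (hv : v ≠ fun _ => 0) :
    1 ∈ List.ofFn v := by
  obtain ⟨j, hj⟩ := Function.ne_iff.1 hv
  exact List.mem_ofFn.2 ⟨j, fin_two_eq_one hj⟩

/-- The only word of length `n` without `x₁` is `x₀^n`, and it contributes a multiple of `log^n`. -/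
theorem exists_polylogHom_eq (T : NCSeries) (n : ℕ) :
    ∃ (κ : ℂ) (g : CleftFun), VanishesAtZero g ∧ polylogHom T n = κ • cleftLog ^ n + g := by
  classical
  refine ⟨T.coeff (List.replicate n 0) * (n.factorial : ℂ)⁻¹,
    ∑ v ∈ Finset.univ.erase (fun _ : Fin n => 0), T.coeff (List.ofFn v) • polylog (List.ofFn v),
    VanishesAtZero.sum _ fun v hv =>
      (vanishesAtZero_polylog (exists_ofFn_one_mem (Finset.ne_of_mem_erase hv))).smul _, ?_⟩
  rw [polylogHom, ← Finset.add_sum_erase _ _ (Finset.mem_univ (fun _ : Fin n => (0 : Fin 2))),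
    List.ofFn_const, polylog_replicate_zero, mul_smul]

/-- By induction both sides have the same derivative, since residuals are derivations of the shuffle
product. Their difference is a multiple of `log^(n+1)` plus a vanishing function at `0`, hence zero.
-/
theorem polylogHom_mul (S T : NCSeries) (n : ℕ) :
    polylogHom (S * T) n =
      ∑ p ∈ Finset.HasAntidiagonal.antidiagonal n, polylogHom S p.1 * polylogHom T p.2 := by
  induction n generalizing S T with
  | zero =>
    simp [polylogHom_zero, NCSeries.coeff_mul_nil, smul_smul, mul_comm]
  | succ n ih =>
    have hcoef : ∃ κ : ℂ, VanishesAtZero ((polylogHom (S * T) (n + 1) -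
        ∑ p ∈ Finset.HasAntidiagonal.antidiagonal (n + 1), polylogHom S p.1 * polylogHom T p.2) -
          κ • cleftLog ^ (n + 1)) := by
      choose a f hf haf using exists_polylogHom_eq S
      choose b g hg hbg using exists_polylogHom_eq T
      obtain ⟨c, k, hk, hck⟩ := exists_polylogHom_eq (S * T) (n + 1)
      refine ⟨c - ∑ p ∈ Finset.HasAntidiagonal.antidiagonal (n + 1), a p.1 * b p.2, ?_⟩
      have : VanishesAtZero (k - ∑ p ∈ Finset.HasAntidiagonal.antidiagonal (n + 1),
          (b p.2 • (f p.1 * cleftLog ^ p.2) + a p.1 • (g p.2 * cleftLog ^ p.1) +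
            f p.1 * g p.2)) :=
        hk.sub (VanishesAtZero.sum _ fun p _ =>
          ((((hf _).mul_cleftLog_pow _).smul _).add (((hg _).mul_cleftLog_pow _).smul _)).add
            ((hf _).mul (hg _)))
      refine cast ?_ this
      congr 1
      rw [hck, sub_smul, Finset.sum_smul, sub_eq_sub_iff_add_eq_add]
      have e : ∀ p ∈ Finset.HasAntidiagonal.antidiagonal (n + 1), polylogHom S p.1 * polylogHom T p.2 =
          (a p.1 * b p.2) • cleftLog ^ (n + 1) + (b p.2 • (f p.1 * cleftLog ^ p.2) +
            a p.1 • (g p.2 * cleftLog ^ p.1) + f p.1 * g p.2) := by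
        intro p hp
        rw [haf, hbg, ← Finset.HasAntidiagonal.mem_antidiagonal.1 hp, pow_add]
        ext z
        simp only [Pi.add_apply, Pi.mul_apply, Pi.smul_apply, smul_eq_mul]
        ring
      rw [Finset.sum_congr rfl e, Finset.sum_add_distrib]
      abel
    obtain ⟨κ, hκ⟩ := hcoef
    refine sub_eq_zero.1 (eq_zero_of_hasCleftDeriv_zero ?_ hκ)
    have hd : ∀ (U : NCSeries) (m : ℕ), HasCleftDeriv (polylogHom U m) (match m with
        | 0 => 0
        | m + 1 => ∑ i : Fin 2, cleftForm i * polylogHom (U.residual i) m) := by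
      intro U m
      cases m with
      | zero =>
        rw [polylogHom_zero]
        simpa using HasCleftDeriv.one.smul (U.coeff [])
      | succ m => exact hasCleftDeriv_polylogHom U m
    have h := (hasCleftDeriv_polylogHom (S * T) n).sub
      (HasCleftDeriv.sum (Finset.HasAntidiagonal.antidiagonal (n + 1)) fun p _ => (hd S p.1).mul (hd T p.2))
    refine cast ?_ h
    congr 1
    -- Factors of degree `0` have derivative `0`; removing these terms turns both sums into sums
    -- over the antidiagonal of `n`.
    rw [sub_eq_zero, Finset.sum_add_distrib, Finset.Nat.sum_antidiagonal_succ,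
      Finset.Nat.sum_antidiagonal_succ' (n := n)]
    simp only [zero_mul, mul_zero, zero_add, NCSeries.residual_mul, polylogHom_add, ih,
      Finset.sum_mul, Finset.mul_sum, mul_add, Finset.sum_add_distrib]
    rw [Finset.sum_comm (s := Finset.HasAntidiagonal.antidiagonal n), Finset.sum_comm (s := Finset.HasAntidiagonal.antidiagonal n)]
    congr 1
    · simp only [mul_assoc]
    · simp only [mul_left_comm]

/-! ### Wronskians and residues of rational functions, in terms of polynomials -/

open Polynomial in
theorem X_sub_C_mul_derivative_pow_mul (a : ℂ) (k : ℕ) (p : ℂ[X]) :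
    (X - C a) * derivative ((X - C a) ^ k * p) =
      (X - C a) ^ k * ((k : ℂ[X]) * p + (X - C a) * derivative p) := by
  cases k with
  | zero => simp
  | succ k =>
    rw [derivative_mul, derivative_X_sub_C_pow]
    simp only [Nat.add_sub_cancel, map_natCast]
    ring

-- The quotient `q/p` has derivative zero. Subtracting its value at a point `a` with `p(a) ≠ 0`
-- gives `r` with a zero of some order `m > 0` at `a`; comparing leading terms in `p r' = p' r`
-- yields `m p(a) s(a) = 0`, where `s(a) ≠ 0`.
open Polynomial in
theorem exists_eq_C_mul_of_wronskian {p q : ℂ[X]} (hp : p ≠ 0)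
    (h : p * derivative q = derivative p * q) : ∃ c : ℂ, q = C c * p := by
  obtain ⟨a, ha⟩ : ∃ a, p.eval a ≠ 0 := by
    by_contra! hc
    exact hp (Polynomial.funext fun a => by simpa using hc a)
  refine ⟨q.eval a / p.eval a, ?_⟩
  by_contra hne
  set r := q - C (q.eval a / p.eval a) * p with hr
  have hr0 : r ≠ 0 := sub_ne_zero.2 hne
  have hra : r.IsRoot a := by simp [hr, ha]
  have hw : p * derivative r = derivative p * r := by
    rw [hr, derivative_sub, derivative_C_mul, mul_sub, h]
    ring
  obtain ⟨s, hs, hsd⟩ := exists_eq_pow_rootMultiplicity_mul_and_not_dvd r hr0 a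
  have hm : r.rootMultiplicity a ≠ 0 := ((rootMultiplicity_pos hr0).2 hra).ne'
  set m := r.rootMultiplicity a
  have hXa : (X - C a : ℂ[X]) ^ m ≠ 0 := pow_ne_zero _ (X_sub_C_ne_zero a)
  have h1 : (X - C a) ^ m * (p * ((m : ℂ[X]) * s + (X - C a) * derivative s)) =
      (X - C a) ^ m * ((X - C a) * derivative p * s) := by
    calc _ = p * ((X - C a) * derivative r) := by
          conv_rhs => rw [hs, X_sub_C_mul_derivative_pow_mul]
          ring
      _ = (X - C a) * (derivative p * r) := by rw [← hw]; ring
      _ = _ := by conv_lhs => rw [hs]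
                  ring
  have h2 := congrArg (eval a) (mul_left_cancel₀ hXa h1)
  simp only [eval_mul, eval_add, eval_sub, eval_X, eval_C, sub_self, zero_mul, add_zero,
    eval_natCast, mul_eq_zero, Nat.cast_eq_zero, ha, hm, false_or] at h2
  exact hsd (dvd_iff_isRoot.2 h2)

open Polynomial in
/-- The derivative of a rational function has no residues. -/
theorem eval_eq_zero_of_residue {p q r t : ℂ[X]} {a : ℂ} (hp : p ≠ 0) (ht : t.eval a ≠ 0)
    (h : (X - C a) * (derivative p * q - p * derivative q) * t = p ^ 2 * r) : r.eval a = 0 := by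
  by_cases hq : q = 0
  · subst hq
    simp only [mul_zero, derivative_zero, sub_zero, zero_mul] at h
    have : r = 0 := (mul_eq_zero.1 h.symm).resolve_left (pow_ne_zero 2 hp)
    simp [this]
  obtain ⟨u, hu, hud⟩ := exists_eq_pow_rootMultiplicity_mul_and_not_dvd p hp a
  obtain ⟨v, hv, hvd⟩ := exists_eq_pow_rootMultiplicity_mul_and_not_dvd q hq a
  set k := p.rootMultiplicity a
  set m := q.rootMultiplicity a
  have hua : u.eval a ≠ 0 := fun e => hud (dvd_iff_isRoot.2 e)
  have hva : v.eval a ≠ 0 := fun e => hvd (dvd_iff_isRoot.2 e)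
  have hXa : ∀ n, (X - C a : ℂ[X]) ^ n ≠ 0 := fun n => pow_ne_zero _ (X_sub_C_ne_zero a)
  -- `w` is `(X - a)(p'q - pq')` with the factor `(X - a)^(k+m)` removed.
  set w : ℂ[X] := ((k : ℂ[X]) * u + (X - C a) * derivative u) * v -
    u * ((m : ℂ[X]) * v + (X - C a) * derivative v) with hw
  have hwa : w.eval a = (k - m) * (u.eval a * v.eval a) := by
    simp [hw]
    ring
  have h1 : (X - C a) ^ (k + m) * (w * t) = (X - C a) ^ (2 * k) * (u ^ 2 * r) := by
    calc _ = ((X - C a) * derivative p * q - p * ((X - C a) * derivative q)) * t := by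
          conv_rhs => rw [hu, hv, X_sub_C_mul_derivative_pow_mul, X_sub_C_mul_derivative_pow_mul]
          rw [hw]
          ring
      _ = p ^ 2 * r := by rw [← h]; ring
      _ = _ := by conv_lhs => rw [hu]
                  ring
  -- If `m < k`, then `q/p` has a pole at `a` and its derivative a pole of order at least two, while
  -- `h` allows at most a simple one. Otherwise `q/p` is regular at `a`, and so is its derivative.
  rcases lt_or_ge m k with hmk | hmk
  · exfalso
    obtain ⟨d, hd⟩ := Nat.exists_eq_add_of_lt hmk
    rw [show 2 * k = (k + m) + (d + 1) by omega, pow_add _ (k + m), mul_assoc] at h1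
    have h2 := congrArg (eval a) (mul_left_cancel₀ (hXa _) h1)
    simp only [eval_mul, hwa, eval_pow, eval_sub, eval_X, eval_C, sub_self, ne_eq,
      Nat.add_eq_zero_iff, one_ne_zero, and_false, not_false_eq_true, zero_pow, zero_mul,
      mul_eq_zero, hua, hva, ht, or_false, sub_eq_zero, Nat.cast_inj] at h2
    omega
  · obtain ⟨d, hd⟩ := Nat.exists_eq_add_of_le hmk
    rw [show k + m = 2 * k + d by omega, pow_add _ (2 * k), mul_assoc] at h1
    have h2 := congrArg (eval a) (mul_left_cancel₀ (hXa _) h1)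
    simp only [eval_mul, eval_pow, eval_sub, eval_X, eval_C, sub_self, hwa] at h2
    have h3 : (0 : ℂ) ^ d * ((k : ℂ) - m) = 0 := by
      cases d with
      | zero => simp [hd]
      | succ d => simp
    rw [← mul_assoc, ← mul_assoc, h3, zero_mul, zero_mul] at h2
    exact (mul_eq_zero.1 h2.symm).resolve_left (pow_ne_zero 2 hua)

/-! ### Linear independence over the polynomials -/

/-- Indices of the products `ℓ Li_{x₀^n}`. -/
abbrev LIndex := Option XWord × ℕ

/-- The factors `ℓ`. -/
def polylogHead : Option XWord → CleftFun
  | none => 1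
  | some u => polylog (u ++ [1])

/-- The products `ℓ Li_{x₀^n}`. -/
def polylogL (j : LIndex) : CleftFun :=
  polylogHead j.1 * polylog (List.replicate j.2 0)

/-- The weight of an index. -/
def LIndex.weight : LIndex → ℕ
  | (none, n) => n
  | (some u, n) => u.length + 1 + n

namespace LIndex

open Polynomial

/-- Polynomial functions on the cleft plane. -/
def polyFun : ℂ[X] →ₐ[ℂ] CleftFun := aeval fun z : cleftPlane => (z : ℂ)

theorem polyFun_apply (p : ℂ[X]) (z : cleftPlane) : polyFun p z = p.eval (z : ℂ) := by
  induction p using Polynomial.induction_on' with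
  | add p q hp hq => simp [hp, hq]
  | monomial n a => simp [polyFun]

theorem eq_zero_of_forall_eval {p : ℂ[X]} (h : ∀ z ∈ cleftPlane, p.eval z = 0) : p = 0 := by
  have hm : ((1 / 2 : ℝ) : ℂ) ∈ cleftPlane := ofReal_mem_cleftPlane (by norm_num) (by norm_num)
  exact eq_zero_of_infinite_isRoot p
    ((infinite_of_mem_nhds _ (isOpen_cleftPlane.mem_nhds hm)).mono h)

theorem polyFun_injective : Function.Injective polyFun := by
  rw [injective_iff_map_eq_zero]
  intro p hp
  refine eq_zero_of_forall_eval fun z hz => ?_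
  rw [← polyFun_apply p ⟨z, hz⟩, hp]
  rfl

/-- The derivation `z (1 - z) d/dz` of the polynomials. -/
def polyDer : ℂ[X] →ₗ[ℂ] ℂ[X] := LinearMap.mulLeft ℂ (X * (1 - X)) ∘ₗ derivative

theorem polyDer_apply (p : ℂ[X]) : polyDer p = X * (1 - X) * derivative p := rfl

/-- The part of `z (1 - z) (ℓ Li_{x₀^n})'` in which `ℓ` is differentiated. -/
def derLeft : LIndex → LIndex →₀ ℂ[X]
  | (none, _) => 0
  | (some [], n) => Finsupp.single (none, n) X
  | (some (i :: u), n) => Finsupp.single (some u, n) (if i = 0 then 1 - X else X)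

/-- The part of `z (1 - z) (ℓ Li_{x₀^n})'` in which `Li_{x₀^n}` is differentiated. -/
def derRight : LIndex → LIndex →₀ ℂ[X]
  | (_, 0) => 0
  | (l, n + 1) => Finsupp.single (l, n) (1 - X)

/-- The derivation `z (1 - z) d/dz` of formal combinations of products `ℓ Li_{x₀^n}`. -/
def formalDer : (LIndex →₀ ℂ[X]) →ₗ[ℂ] (LIndex →₀ ℂ[X]) :=
  Finsupp.lsum ℂ fun j => Finsupp.lsingle j ∘ₗ polyDer +
    (LinearMap.toSpanSingleton ℂ[X] _ (derLeft j + derRight j)).restrictScalars ℂ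

theorem formalDer_single (j : LIndex) (p : ℂ[X]) :
    formalDer (Finsupp.single j p) =
      Finsupp.single j (polyDer p) + p • (derLeft j + derRight j) := by
  simp [formalDer]

/-- The terms of the coefficients of `formalDer P` that do not come from differentiating the
coefficients of `P`. -/
def derCoeff (P : LIndex →₀ ℂ[X]) : LIndex → ℂ[X]
  | (none, n) => (1 - X) * P (none, n + 1) + X * P (some [], n)
  | (some u, n) => (1 - X) * (P (some u, n + 1) + P (some (0 :: u), n)) + X * P (some (1 :: u), n)

/-- `derCoeff` is the transpose of `derLeft + derRight`: it lists the indices whose derivative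
involves `j`. These have one more `x₀` in the logarithmic factor or one more letter at the front of
the word of `ℓ`. -/
theorem formalDer_apply (P : LIndex →₀ ℂ[X]) (j : LIndex) :
    formalDer P j = polyDer (P j) + derCoeff P j := by
  induction P using Finsupp.induction_linear with
  | zero => rcases j with ⟨_ | u, n⟩ <;> simp [derCoeff]
  | add P Q hP hQ =>
    rw [map_add, Finsupp.add_apply, hP, hQ, Finsupp.add_apply, map_add]
    rcases j with ⟨_ | u, n⟩ <;> simp only [derCoeff, Finsupp.add_apply] <;> ring
  | single k p =>
    rw [formalDer_single]
    have e : polyDer (Finsupp.single k p j) = Finsupp.single k (polyDer p) j := by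
      simp only [Finsupp.single_apply]
      split_ifs <;> simp
    rw [Finsupp.add_apply, e]
    congr 1
    rcases j with ⟨_ | u, n⟩ <;> rcases k with ⟨_ | _ | ⟨i, v⟩, _ | m⟩ <;>
      simp only [derCoeff, derLeft, derRight, Finsupp.single_apply, Finsupp.add_apply,
        Finsupp.smul_apply, Prod.mk.injEq, smul_eq_mul, Finsupp.coe_zero, Pi.zero_apply] <;>
      try fin_cases i
    all_goals (simp; try (split_ifs <;> simp_all [mul_comm]))

end LIndex

/-! ### Polynomial relations between the products `ℓ Li_{x₀^n}` -/

namespace LIndex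

open Polynomial

/-- Evaluation of formal combinations of products `ℓ Li_{x₀^n}`. -/
def evalL : (LIndex →₀ ℂ[X]) →ₗ[ℂ] CleftFun :=
  Finsupp.lsum ℂ fun j => LinearMap.mulRight ℂ (polylogL j) ∘ₗ polyFun.toLinearMap

theorem evalL_single (j : LIndex) (p : ℂ[X]) :
    evalL (Finsupp.single j p) = polyFun p * polylogL j := by
  simp [evalL]

theorem evalL_smul (p : ℂ[X]) (P : LIndex →₀ ℂ[X]) : evalL (p • P) = polyFun p * evalL P := by
  induction P using Finsupp.induction_linear with
  | zero => simp
  | add P Q hP hQ => rw [smul_add, map_add, hP, hQ, map_add, mul_add]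
  | single j q => rw [Finsupp.smul_single, evalL_single, evalL_single, smul_eq_mul, map_mul,
      mul_assoc]

theorem polyFun_X_mul_cleftForm_zero : polyFun X * cleftForm 0 = 1 := by
  ext z
  have := cleftPlane_ne_zero z.2
  simp [polyFun_apply, cleftForm, this]

theorem polyFun_one_sub_X_mul_cleftForm_one : polyFun (1 - X) * cleftForm 1 = 1 := by
  ext z
  have := one_sub_cleftPlane_ne_zero z.2
  rw [Pi.mul_apply, polyFun_apply]
  simp [cleftForm, this]

theorem polyFun_mul_cleftForm (i : Fin 2) :
    polyFun (X * (1 - X)) * cleftForm i = polyFun (if i = 0 then 1 - X else X) := by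
  by_cases hi : i = 0
  · rw [if_pos hi, hi, map_mul, mul_right_comm, polyFun_X_mul_cleftForm_zero, one_mul]
  · rw [if_neg hi, fin_two_eq_one hi, map_mul, mul_assoc, polyFun_one_sub_X_mul_cleftForm_one,
      mul_one]

theorem hasCleftDeriv_polyFun (p : ℂ[X]) : HasCleftDeriv (polyFun p) (polyFun (derivative p)) := by
  have e : ∀ q : ℂ[X], polyFun q = fun z : cleftPlane => q.eval (z : ℂ) := fun q =>
    funext (polyFun_apply q)
  rw [e, e]
  exact HasCleftDeriv.of_hasDerivAt (F := fun z => p.eval z) (f := fun z => (derivative p).eval z)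
    fun z _ => p.hasDerivAt z

theorem exists_hasCleftDeriv_polylogL (j : LIndex) :
    ∃ f, HasCleftDeriv (polylogL j) f ∧
      polyFun (X * (1 - X)) * f = evalL (derLeft j + derRight j) := by
  obtain ⟨l, n⟩ := j
  have hl : ∃ f, HasCleftDeriv (polylogHead l) f ∧
      polyFun (X * (1 - X)) * f * polylog (List.replicate n 0) = evalL (derLeft (l, n)) := by
    rcases l with _ | _ | ⟨i, u⟩
    · exact ⟨0, HasCleftDeriv.one, by simp [derLeft]⟩
    · refine ⟨_, hasCleftDeriv_polylog_cons 1 [], ?_⟩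
      rw [← mul_assoc, polyFun_mul_cleftForm, derLeft, evalL_single, polylogL, polylog_nil, polylogHead]
      simp
    · refine ⟨cleftForm i * polylog (u ++ [1]), ?_, ?_⟩
      · rw [polylogHead, List.cons_append]
        exact hasCleftDeriv_polylog_cons i (u ++ [1])
      rw [← mul_assoc, polyFun_mul_cleftForm, derLeft, evalL_single, polylogL, mul_assoc,
        polylogHead]
  have hn : ∃ g, HasCleftDeriv (polylog (List.replicate n 0)) g ∧
      polylogHead l * (polyFun (X * (1 - X)) * g) = evalL (derRight (l, n)) := by
    cases n with
    | zero => exact ⟨0, by simpa [polylog_nil] using HasCleftDeriv.one, by simp [derRight]⟩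
    | succ n =>
      refine ⟨_, hasCleftDeriv_polylog_cons 0 (List.replicate n 0), ?_⟩
      rw [← mul_assoc (polyFun _), polyFun_mul_cleftForm, derRight, evalL_single, polylogL, if_pos rfl]
      ring
  obtain ⟨f, hf, hf'⟩ := hl
  obtain ⟨g, hg, hg'⟩ := hn
  refine ⟨_, hf.mul hg, ?_⟩
  rw [map_add, ← hf', ← hg']
  ring

theorem exists_hasCleftDeriv_evalL (P : LIndex →₀ ℂ[X]) :
    ∃ f, HasCleftDeriv (evalL P) f ∧ polyFun (X * (1 - X)) * f = evalL (formalDer P) := by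
  induction P using Finsupp.induction_linear with
  | zero => exact ⟨0, by simpa using HasCleftDeriv.zero, by simp⟩
  | add P Q hP hQ =>
    obtain ⟨f, hf, hf'⟩ := hP
    obtain ⟨g, hg, hg'⟩ := hQ
    exact ⟨f + g, by simpa using hf.add hg, by rw [mul_add, hf', hg', map_add, map_add]⟩
  | single j p =>
    obtain ⟨f, hf, hf'⟩ := exists_hasCleftDeriv_polylogL j
    refine ⟨_, by rw [evalL_single]; exact (hasCleftDeriv_polyFun p).mul hf, ?_⟩
    rw [formalDer_single, map_add, evalL_single, evalL_smul, ← hf', polyDer_apply,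
      map_mul polyFun (X * (1 - X))]
    ring

/-- Relations are stable under the formal derivation. The factor `z(1-z)` is there to keep the
coefficients polynomial. -/
theorem evalL_formalDer_eq_zero {P : LIndex →₀ ℂ[X]} (h : evalL P = 0) :
    evalL (formalDer P) = 0 := by
  obtain ⟨f, hf, hf'⟩ := exists_hasCleftDeriv_evalL P
  rw [h] at hf
  have : f = 0 := funext fun z => (hf z).unique (HasCleftDeriv.zero z)
  rw [← hf', this, mul_zero]

/-- Differentiating a product `ℓ Li_{x₀^n}` lowers its weight by exactly one. -/
theorem derCoeff_eq_zero {P : LIndex →₀ ℂ[X]} {d : ℕ} (hP : ∀ j, d < weight j → P j = 0)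
    {j : LIndex} (hj : d ≤ weight j) : derCoeff P j = 0 := by
  rcases j with ⟨_ | u, n⟩ <;> simp only [weight] at hj
  · rw [derCoeff, hP _ (by simp only [weight]; omega),
      hP _ (by simp only [weight, List.length_nil]; omega)]
    simp
  · rw [derCoeff, hP _ (by simp only [weight]; omega),
      hP _ (by simp only [weight, List.length_cons]; omega),
      hP _ (by simp only [weight, List.length_cons]; omega)]
    simp

/-- If the top coefficients are constant multiples of `p` and the next ones satisfy the differential
system, then the constants vanish. -/
theorem constants_eq_zero {P : LIndex →₀ ℂ[X]} {d : ℕ} {p : ℂ[X]} (hp : p ≠ 0) {c : LIndex → ℂ}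
    (hc : ∀ j, weight j = d + 1 → P j = C (c j) * p)
    (h : ∀ j, weight j = d → p * (polyDer (P j) + derCoeff P j) = polyDer p * P j) {j : LIndex}
    (hj : weight j = d + 1) : c j = 0 := by
  -- The equation `h` becomes `(P j / p)' = -(A/z + B/(1-z))`, and a derivative of a rational
  -- function has no residues at `0` and `1`.
  have key : ∀ j, weight j = d → ∀ A B : ℂ, derCoeff P j = ((1 - X) * C A + X * C B) * p →
      A = 0 ∧ B = 0 := by
    intro j hj A B hAB
    have h1 := h j hj
    rw [hAB, polyDer_apply, polyDer_apply] at h1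
    -- `t` is the complementary factor of `X (1 - X)`: `1 - X` for `a = 0`, and `-X` for `a = 1`.
    have h0 : ∀ a : ℂ, ∀ t : ℂ[X], (X - C a) * t = X * (1 - X) → t.eval a ≠ 0 →
        ((1 - X) * C A + X * C B : ℂ[X]).eval a = 0 := by
      intro a t hat hta
      refine eval_eq_zero_of_residue (q := P j) hp hta ?_
      calc _ = ((X - C a) * t) * (derivative p * P j - p * derivative (P j)) := by ring
        _ = _ := by rw [hat]; linear_combination -h1
    constructor
    · simpa using h0 0 (1 - X) (by simp) (by simp)
    · simpa using h0 1 (-X) (by simp; ring) (by simp)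
  have hnone : ∀ n, weight (none, n) = d → c (none, n + 1) = 0 ∧ c (some [], n) = 0 := by
    intro n hn
    refine key _ hn _ _ ?_
    rw [derCoeff, hc (none, n + 1) (by rw [← hn]; rfl),
      hc (some [], n) (by rw [← hn]; simp only [weight, List.length_nil]; omega)]
    ring
  have hsome : ∀ u n, weight (some u, n) = d →
      c (some u, n + 1) + c (some (0 :: u), n) = 0 ∧ c (some (1 :: u), n) = 0 := by
    intro u n hn
    refine key _ hn _ _ ?_
    rw [derCoeff, hc (some u, n + 1) (by rw [← hn]; rfl),
      hc (some (0 :: u), n) (by rw [← hn]; simp only [weight, List.length_cons]; omega),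
      hc (some (1 :: u), n) (by rw [← hn]; simp only [weight, List.length_cons]; omega), C_add]
    ring
  obtain ⟨l, n⟩ := j
  cases l with
  | none =>
    simp only [weight] at hj
    subst hj
    exact (hnone d rfl).1
  | some u =>
    -- A first letter `x₁` is settled directly. For `x₀` only a sum of two constants is known to
    -- vanish, so the letter is traded for an increase of `n` with `u` shortened, at the same
    -- weight.
    induction u generalizing n with
    | nil =>
      simp only [weight, List.length_nil] at hj
      exact (hnone n (by simp only [weight]; omega)).2
    | cons i u ih =>
      simp only [weight, List.length_cons] at hj
      have h1 := hsome u n (by simp only [weight]; omega)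
      by_cases hi : i = 0
      · have h2 := ih (n + 1) (by simp only [weight]; omega)
        rw [hi]
        simpa [h2] using h1.1
      · rw [fin_two_eq_one hi]
        exact h1.2

/-- Induction on a bound `d` for the weight and on the number of nonzero coefficients of top weight.
If `p` is one of these, `p ∂P - ∂p P` is a relation with fewer of them, hence zero. Thus every top
coefficient is a constant multiple of `p`, and `constants_eq_zero` gives `p = 0`. -/
theorem eq_zero_of_evalL_eq_zero_aux (d m : ℕ) (P : LIndex →₀ ℂ[X])
    (hd : ∀ j, d < weight j → P j = 0)
    (hm : (P.support.filter fun j => weight j = d).card ≤ m) (hP : evalL P = 0) : P = 0 := by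
  induction d generalizing m P with
  | zero =>
    -- The only index of weight `0` is that of the function `1`, so the relation is a single
    -- polynomial.
    have e : P = Finsupp.single (none, 0) (P (none, 0)) := by
      ext1 j
      by_cases hj : (none, 0) = j
      · rw [← hj, Finsupp.single_eq_same]
      · rw [Finsupp.single_eq_of_ne (Ne.symm hj)]
        apply hd
        rcases j with ⟨_ | u, n⟩
        · simp only [weight]
          exact Nat.pos_of_ne_zero fun h0 => hj (by rw [h0])
        · simp only [weight]
          omega
    rw [e, evalL_single] at hP
    have h1 : polylogL (none, 0) = 1 := by simp [polylogL, polylogHead, polylog_nil]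
    rw [h1, mul_one] at hP
    rw [e, (injective_iff_map_eq_zero _).1 polyFun_injective _ hP, Finsupp.single_zero]
  | succ d ihd =>
    induction m generalizing P with
    | zero =>
      refine ihd _ P (fun j hj => ?_) le_rfl hP
      by_contra hne
      rcases (Nat.succ_le_of_lt hj).eq_or_lt with h1 | h1
      · have : j ∈ P.support.filter fun j => weight j = d + 1 := by
          simp [hne, h1.symm]
        rw [Finset.card_eq_zero.1 (Nat.le_zero.1 hm)] at this
        simp at this
      · exact hne (hd j h1)
    | succ m ihm =>
      by_cases hw : ∃ w, P w ≠ 0 ∧ weight w = d + 1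
      · exfalso
        obtain ⟨w, hw0, hw⟩ := hw
        set p := P w with hp
        set Q : LIndex →₀ ℂ[X] := p • formalDer P - polyDer p • P with hQ
        have hQa : ∀ j, Q j = p * (polyDer (P j) + derCoeff P j) - polyDer p * P j := fun j => by
          simp [hQ, formalDer_apply]
        have htop : ∀ j, weight j = d + 1 → Q j = p * polyDer (P j) - polyDer p * P j :=
          fun j hj => by rw [hQa, derCoeff_eq_zero hd hj.ge, add_zero]
        have hQ0 : Q = 0 := by
          refine ihm Q (fun j hj => ?_) ?_ ?_
          · rw [hQa, derCoeff_eq_zero hd hj.le, hd j hj]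
            simp
          · have hsub : (Q.support.filter fun j => weight j = d + 1) ⊆
                (P.support.filter fun j => weight j = d + 1).erase w := by
              intro j hj
              simp only [Finset.mem_filter, Finsupp.mem_support_iff, Finset.mem_erase] at hj ⊢
              obtain ⟨hj1, hj2⟩ := hj
              rw [htop j hj2] at hj1
              refine ⟨?_, ?_, hj2⟩
              · rintro rfl
                exact hj1 (by rw [← hp]; ring)
              · intro h0
                exact hj1 (by rw [h0]; simp)
            have hmem : w ∈ P.support.filter fun j => weight j = d + 1 := by
              simp [← hp, hw0, hw]
            have := Finset.card_le_card hsub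
            rw [Finset.card_erase_of_mem hmem] at this
            omega
          · rw [hQ, map_sub, evalL_smul, evalL_smul, hP, evalL_formalDer_eq_zero hP]
            simp
        have hX : (X * (1 - X) : ℂ[X]) ≠ 0 := by
          intro h0
          have := congrArg (eval (2 : ℂ)) h0
          norm_num at this
        have hex : ∀ j, ∃ c : ℂ, weight j = d + 1 → P j = C c * p := by
          intro j
          by_cases hj : weight j = d + 1
          · have h1 := htop j hj
            rw [hQ0, Finsupp.zero_apply, polyDer_apply, polyDer_apply] at h1
            obtain ⟨c, hc⟩ := exists_eq_C_mul_of_wronskian hw0 (q := P j)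
              (mul_left_cancel₀ hX (by linear_combination -h1))
            exact ⟨c, fun _ => hc⟩
          · exact ⟨0, fun h => absurd h hj⟩
        choose c hc using hex
        have hcw := constants_eq_zero hw0 hc (fun j hj => by
          have := hQa j
          rw [hQ0, Finsupp.zero_apply] at this
          exact (sub_eq_zero.1 this.symm)) hw
        have := hc w hw
        rw [hcw, C_0, zero_mul] at this
        exact hw0 this
      -- No coefficient of weight `d + 1` is left, so the bound on the weight drops.
      · push Not at hw
        refine ihd _ P (fun j hj => ?_) le_rfl hP
        rcases (Nat.succ_le_of_lt hj).eq_or_lt with h1 | h1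
        · by_contra hne
          exact hw j hne h1.symm
        · exact hd j h1

theorem evalL_injective : Function.Injective evalL := by
  rw [injective_iff_map_eq_zero]
  intro P hP
  exact eq_zero_of_evalL_eq_zero_aux (P.support.sup weight) _ P (fun j hj => by
    by_contra hne
    exact absurd (Finset.le_sup (f := weight) (Finsupp.mem_support_iff.2 hne)) (not_le.2 hj))
    le_rfl hP

end LIndex

/-! ### Partial fractions -/

/-- The rational factors of the elements of `ℬ`. -/
def ratB : ℤ ⊕ ℕ → CleftFun
  | .inl k => fun z => (z : ℂ) ^ k
  | .inr l => fun z => ((1 - (z : ℂ)) ^ (l + 1))⁻¹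

theorem polylogB_eq (r : ℤ ⊕ ℕ) (j : LIndex) : polylogB (r, j) = ratB r * polylogL j := by
  rw [polylogL, ← mul_assoc]
  rcases r with k | l <;> rcases j with ⟨_ | u, n⟩ <;> rfl

-- Multiplication by `t^N` clears the negative exponents; the resulting polynomial composed with `t`
-- vanishes on an infinite set, and `t` is not constant. It serves for `t = X` and `t = 1 - X`.
open Polynomial LIndex in
theorem linearIndependent_zpow_affine (t : ℂ[X]) (ht : t.natDegree ≠ 0)
    (h0 : ∀ z ∈ cleftPlane, t.eval z ≠ 0) :
    LinearIndependent ℂ fun (k : ℤ) (z : cleftPlane) => t.eval (z : ℂ) ^ k := by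
  rw [linearIndependent_iff']
  intro s g hg k₀ hk₀
  set N : ℕ := ∑ k ∈ s, k.natAbs with hN
  have hkN : ∀ k ∈ s, 0 ≤ k + N := fun k hk => by
    have : k.natAbs ≤ N := Finset.single_le_sum (f := Int.natAbs) (fun _ _ => Nat.zero_le _) hk
    omega
  set p : ℂ[X] := ∑ k ∈ s, monomial (k + N).toNat (g k) with hp
  have hpt : p.comp t = 0 := by
    refine eq_zero_of_forall_eval fun z hz => ?_
    have hz0 := h0 z hz
    have h1 := congrFun hg ⟨z, hz⟩
    simp only [Finset.sum_apply, Pi.smul_apply, smul_eq_mul, Pi.zero_apply] at h1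
    rw [eval_comp, hp, eval_finsetSum]
    calc _ = ∑ k ∈ s, t.eval z ^ (N : ℤ) * (g k * t.eval z ^ k) := by
          refine Finset.sum_congr rfl fun k hk => ?_
          rw [eval_monomial, ← zpow_natCast, Int.toNat_of_nonneg (hkN k hk), zpow_add₀ hz0]
          ring
      _ = 0 := by rw [← Finset.mul_sum, h1, mul_zero]
  have hp0 : p = 0 := by
    rcases comp_eq_zero_iff.1 hpt with h | ⟨_, h⟩
    · exact h
    · exact absurd (by rw [h, natDegree_C]) ht
  have := congrArg (fun q => coeff q (k₀ + N).toNat) hp0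
  simp only [hp, finsetSum_coeff, coeff_monomial, coeff_zero] at this
  rwa [Finset.sum_eq_single k₀ (fun k hk hne => if_neg fun he => hne (by
    have := hkN k hk
    have := hkN k₀ hk₀
    omega)) (fun h => absurd hk₀ h), if_pos rfl] at this

open Polynomial LIndex in
theorem linearIndependent_ratB : LinearIndependent ℂ ratB := by
  have e : ratB = Sum.elim (fun (k : ℤ) (z : cleftPlane) => (z : ℂ) ^ k)
      (fun (l : ℕ) (z : cleftPlane) => ((1 - (z : ℂ)) ^ (l + 1))⁻¹) := by
    ext (k | l) z <;> rfl
  rw [e]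
  refine LinearIndependent.sum_type ?_ ?_ ?_
  · simpa using linearIndependent_zpow_affine X (by simp) fun z hz => by
      simpa using cleftPlane_ne_zero hz
  · have h := linearIndependent_zpow_affine (1 - X)
      (by rw [← neg_sub, natDegree_neg, ← C_1, natDegree_X_sub_C]; simp) fun z hz => by
        simpa using one_sub_cleftPlane_ne_zero hz
    have h2 := h.comp (fun l : ℕ => -((l : ℤ) + 1)) fun a b hab => by simpa using hab
    refine cast ?_ h2
    congr 1
    ext l z
    simp only [Function.comp_apply, eval_sub, eval_one, eval_X, zpow_neg]
    norm_cast
  -- Uniqueness of partial fractions: `f = A / X^N = B / (X-1)^M` with `deg B < M`. By coprimality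
  -- `(X-1)^M` divides `B`, so `B = 0`.
  · rw [Submodule.disjoint_def]
    intro f hf1 hf2
    have h1 : ∃ (N : ℕ) (A : ℂ[X]), polyFun X ^ N * f = polyFun A := by
      clear hf2
      induction hf1 using Submodule.span_induction with
      | mem f hf =>
        obtain ⟨k, rfl⟩ := hf
        refine ⟨k.natAbs, X ^ (k + k.natAbs).toNat, ?_⟩
        ext z
        have hz := cleftPlane_ne_zero z.2
        simp only [Pi.mul_apply, Pi.pow_apply, polyFun_apply, eval_X, eval_pow]
        rw [← zpow_natCast, ← zpow_natCast, Int.toNat_of_nonneg (by omega), zpow_add₀ hz, mul_comm]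
      | zero => exact ⟨0, 0, by simp⟩
      | add f g _ _ hf hg =>
        obtain ⟨N, A, hA⟩ := hf
        obtain ⟨M, B, hB⟩ := hg
        refine ⟨N + M, X ^ M * A + X ^ N * B, ?_⟩
        rw [map_add, map_mul, map_mul, map_pow, map_pow, ← hA, ← hB]
        ring
      | smul c f _ hf =>
        obtain ⟨N, A, hA⟩ := hf
        exact ⟨N, c • A, by rw [mul_smul_comm, hA, map_smul]⟩
    have h2 : ∃ (M : ℕ) (B : ℂ[X]), B.degree < M ∧ polyFun (X - 1) ^ M * f = polyFun B := by
      have hdeg : ∀ M : ℕ, ((X - 1 : ℂ[X]) ^ M).degree = M := fun M => by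
        rw [degree_pow, ← C_1, degree_X_sub_C]
        simp
      clear hf1 h1
      induction hf2 using Submodule.span_induction with
      | mem f hf =>
        obtain ⟨l, rfl⟩ := hf
        refine ⟨l + 1, C ((-1) ^ (l + 1)), degree_C_le.trans_lt (by exact_mod_cast l.succ_pos), ?_⟩
        ext z
        have hz := one_sub_cleftPlane_ne_zero z.2
        simp only [Pi.mul_apply, Pi.pow_apply, polyFun_apply, eval_X, eval_sub, eval_one, eval_C]
        rw [← neg_sub, neg_pow, mul_assoc, mul_inv_cancel₀ (pow_ne_zero _ hz), mul_one]
      | zero => exact ⟨0, 0, by simp, by simp⟩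
      | add f g _ _ hf hg =>
        obtain ⟨N, A, hAd, hA⟩ := hf
        obtain ⟨M, B, hBd, hB⟩ := hg
        have aux : ∀ (a b : ℕ) (U : ℂ[X]), U.degree < b →
            ((X - 1) ^ a * U).degree < ((a + b : ℕ) : WithBot ℕ) := by
          intro a b U hU
          by_cases hU0 : U = 0
          · rw [hU0, mul_zero, degree_zero]
            exact WithBot.bot_lt_coe _
          rw [degree_mul, hdeg, degree_eq_natDegree hU0] at *
          norm_cast at *
          omega
        refine ⟨N + M, (X - 1) ^ M * A + (X - 1) ^ N * B,
          (degree_add_le _ _).trans_lt (max_lt ?_ (aux N M B hBd)), ?_⟩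
        · rw [add_comm N M]
          exact aux M N A hAd
        rw [map_add, map_mul, map_mul, map_pow, map_pow, ← hA, ← hB]
        ring
      | smul c f _ hf =>
        obtain ⟨N, A, hAd, hA⟩ := hf
        exact ⟨N, c • A, (degree_smul_le c A).trans_lt hAd, by rw [mul_smul_comm, hA, map_smul]⟩
    obtain ⟨N, A, hA⟩ := h1
    obtain ⟨M, B, hBd, hB⟩ := h2
    have hAB : X ^ N * B = (X - 1) ^ M * A := by
      apply polyFun_injective
      rw [map_mul, map_mul, map_pow, map_pow, ← hA, ← hB]
      ring
    have hcop : IsCoprime ((X - 1 : ℂ[X]) ^ M) (X ^ N) :=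
      IsCoprime.pow ⟨-1, 1, by ring⟩
    have hdvd : (X - 1 : ℂ[X]) ^ M ∣ B := hcop.dvd_of_dvd_mul_left ⟨A, hAB⟩
    have hB0 : B = 0 := by
      refine eq_zero_of_dvd_of_degree_lt hdvd ?_
      rwa [degree_pow, ← C_1, degree_X_sub_C, nsmul_one]
    rw [hB0, map_zero] at hB
    ext z
    have hz : (z : ℂ) - 1 ≠ 0 := by
      rw [← neg_sub, neg_ne_zero]
      exact one_sub_cleftPlane_ne_zero z.2
    have := congrFun hB z
    simpa [polyFun_apply, hz] using this

/-! ### `ℬ` is linearly independent -/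

-- Every `n ≥ N` is allowed so that finitely many coefficients can be given a common denominator.
open Polynomial LIndex in
theorem exists_denominator (s : CleftFun) (hs : s ∈ rationalAlg) :
    ∃ N : ℕ, ∀ n ≥ N, ∃ p, polyFun (X * (1 - X)) ^ n * s = polyFun p := by
  induction hs using Algebra.adjoin_induction with
  | mem s hs =>
    refine ⟨1, fun n hn => ?_⟩
    obtain ⟨m, rfl⟩ := Nat.exists_eq_add_of_le hn
    have : ∃ p, polyFun (X * (1 - X)) * s = polyFun p := by
      rcases hs with rfl | rfl | rfl
      · refine ⟨X * (1 - X) * X, ?_⟩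
        ext z
        simp [polyFun_apply]
      · refine ⟨1 - X, ?_⟩
        ext z
        have hz := cleftPlane_ne_zero z.2
        simp only [Pi.mul_apply, polyFun_apply, eval_mul, eval_sub, eval_X, eval_one]
        field_simp
      · refine ⟨X, ?_⟩
        ext z
        have hz := one_sub_cleftPlane_ne_zero z.2
        simp only [Pi.mul_apply, polyFun_apply, eval_mul, eval_sub, eval_X, eval_one]
        field_simp
    obtain ⟨p, hp⟩ := this
    exact ⟨(X * (1 - X)) ^ m * p, by
      rw [map_mul polyFun (_ ^ m), ← hp, map_pow]; ring⟩
  | algebraMap c =>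
    refine ⟨0, fun n _ => ⟨(X * (1 - X)) ^ n * C c, ?_⟩⟩
    rw [map_mul polyFun (_ ^ n), map_pow]
    congr 1
    exact (polyFun.commutes c).symm
  | add s t _ _ hs ht =>
    obtain ⟨N, hN⟩ := hs
    obtain ⟨M, hM⟩ := ht
    refine ⟨max N M, fun n hn => ?_⟩
    obtain ⟨p, hp⟩ := hN n (le_trans (le_max_left _ _) hn)
    obtain ⟨q, hq⟩ := hM n (le_trans (le_max_right _ _) hn)
    exact ⟨p + q, by rw [mul_add, hp, hq, map_add]⟩
  | mul s t _ _ hs ht =>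
    obtain ⟨N, hN⟩ := hs
    obtain ⟨M, hM⟩ := ht
    refine ⟨N + M, fun n hn => ?_⟩
    obtain ⟨p, hp⟩ := hN N le_rfl
    obtain ⟨q, hq⟩ := hM (n - N) (by omega)
    refine ⟨p * q, ?_⟩
    rw [map_mul polyFun p, ← hp, ← hq, ← Nat.add_sub_of_le (show N ≤ n by omega), Nat.add_sub_cancel_left,
      pow_add]
    ring

open Polynomial LIndex in
theorem linearIndependent_polylogL : LinearIndependent rationalAlg polylogL := by
  rw [linearIndependent_iff']
  intro s g hg j₀ hj₀
  choose N hN using fun j => exists_denominator (g j : CleftFun) (g j).2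
  set n := s.sup N
  have : ∀ j, ∃ p, j ∈ s → polyFun (X * (1 - X)) ^ n * (g j : CleftFun) = polyFun p := fun j => by
    by_cases hj : j ∈ s
    · obtain ⟨p, hp⟩ := hN j n (Finset.le_sup hj)
      exact ⟨p, fun _ => hp⟩
    · exact ⟨0, fun h => absurd h hj⟩
  choose p hp using this
  have h0 : evalL (∑ j ∈ s, Finsupp.single j (p j)) = 0 := by
    rw [map_sum]
    calc _ = ∑ j ∈ s, polyFun (X * (1 - X)) ^ n * (g j • polylogL j) := by
          refine Finset.sum_congr rfl fun j hj => ?_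
          rw [evalL_single, ← hp j hj, mul_assoc]
          rfl
      _ = 0 := by rw [← Finset.mul_sum, hg, mul_zero]
  have h1 := DFunLike.congr_fun ((injective_iff_map_eq_zero _).1 evalL_injective _ h0) j₀
  classical
  simp only [Finsupp.finsetSum_apply, Finsupp.single_apply, Finset.sum_ite_eq', if_pos hj₀,
    Finsupp.zero_apply] at h1
  have h2 := hp j₀ hj₀
  rw [h1, map_zero] at h2
  ext z
  have hz := cleftPlane_ne_zero z.2
  have hz1 := one_sub_cleftPlane_ne_zero z.2
  have := congrFun h2 z
  simpa [polyFun_apply, hz, hz1] using this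

theorem ratB_mem (r : ℤ ⊕ ℕ) : ratB r ∈ rationalAlg := by
  have h1 : (fun z => (z : ℂ) : CleftFun) ∈ rationalAlg := Algebra.subset_adjoin (by simp)
  have h2 : (fun z => (z : ℂ)⁻¹ : CleftFun) ∈ rationalAlg := Algebra.subset_adjoin (by simp)
  have h3 : (fun z => (1 - (z : ℂ))⁻¹ : CleftFun) ∈ rationalAlg := Algebra.subset_adjoin (by simp)
  rcases r with k | l
  · rcases k with k | k
    · have := pow_mem h1 k
      refine cast ?_ this
      congr 1
    · have := pow_mem h2 (k + 1)
      refine cast ?_ this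
      congr 1
      ext z
      simp [ratB, zpow_negSucc]
  · have := pow_mem h3 (l + 1)
    refine cast ?_ this
    congr 1
    ext z
    simp [ratB]

/-- Independence in a tower: the rational factors are independent over `ℂ` in `𝒞`, and the products
`ℓ Li_{x₀^n}` are independent over `𝒞`. -/
theorem linearIndependent_polylogB : LinearIndependent ℂ polylogB := by
  have h1 : LinearIndependent ℂ fun r => (⟨ratB r, ratB_mem r⟩ : rationalAlg) :=
    LinearIndependent.of_comp rationalAlg.val.toLinearMap linearIndependent_ratB
  have h2 := linearIndependent_smul h1 linearIndependent_polylogL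
  refine cast ?_ h2
  congr 1
  ext ⟨r, j⟩ z
  rw [polylogB_eq]
  rfl

/-! ### The span of `ℬ` -/

theorem ratB_inl (k : ℤ) : ratB (.inl k) = fun z : cleftPlane => (z : ℂ) ^ k := rfl

theorem ratB_inr (l : ℕ) : ratB (.inr l) = fun z : cleftPlane => ((1 - (z : ℂ)) ^ (l + 1))⁻¹ := rfl

theorem ratB_zero : ratB (.inl 0) = 1 := by
  ext z
  simp [ratB]

/-- The span of the powers of `z` and of `(1 - z)⁻¹`. -/
def ratSpan : Submodule ℂ CleftFun := Submodule.span ℂ (Set.range ratB)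

theorem ratB_mem_ratSpan (r : ℤ ⊕ ℕ) : ratB r ∈ ratSpan := Submodule.subset_span ⟨r, rfl⟩

theorem mul_mem_of_forall_range {ι : Type*} {v : ι → CleftFun} {f : CleftFun}
    {N : Submodule ℂ CleftFun} (h : ∀ i, f * v i ∈ N) {g : CleftFun}
    (hg : g ∈ Submodule.span ℂ (Set.range v)) : f * g ∈ N := by
  have : Submodule.span ℂ (Set.range v) ≤ N.comap (LinearMap.mulLeft ℂ f) := by
    rw [Submodule.span_le]
    rintro _ ⟨i, rfl⟩
    exact h i
  exact this hg

theorem z_mul_mem_ratSpan {g : CleftFun} (hg : g ∈ ratSpan) : ratB (.inl 1) * g ∈ ratSpan := by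
  refine mul_mem_of_forall_range (fun r => ?_) hg
  rcases r with k | l
  · have : ratB (.inl 1) * ratB (.inl k) = ratB (.inl (k + 1)) := by
      ext z
      simp [ratB, zpow_add₀ (cleftPlane_ne_zero z.2), mul_comm]
    rw [this]
    exact ratB_mem_ratSpan _
  · cases l with
    | zero =>
      have : ratB (.inl 1) * ratB (.inr 0) = ratB (.inr 0) - ratB (.inl 0) := by
        ext z
        have := one_sub_cleftPlane_ne_zero z.2
        simp [ratB]
        field_simp
        ring
      rw [this]
      exact sub_mem (ratB_mem_ratSpan _) (ratB_mem_ratSpan _)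
    | succ l =>
      have : ratB (.inl 1) * ratB (.inr (l + 1)) = ratB (.inr (l + 1)) - ratB (.inr l) := by
        ext z
        have := one_sub_cleftPlane_ne_zero z.2
        simp [ratB]
        field_simp
        ring
      rw [this]
      exact sub_mem (ratB_mem_ratSpan _) (ratB_mem_ratSpan _)

theorem z_inv_mul_mem_ratSpan {g : CleftFun} (hg : g ∈ ratSpan) :
    ratB (.inl (-1)) * g ∈ ratSpan := by
  refine mul_mem_of_forall_range (fun r => ?_) hg
  rcases r with k | l
  · have : ratB (.inl (-1)) * ratB (.inl k) = ratB (.inl (-1 + k)) := by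
      ext z
      simp only [ratB, zpow_add₀ (cleftPlane_ne_zero z.2), Pi.mul_apply]
    rw [this]
    exact ratB_mem_ratSpan _
  · induction l with
    | zero =>
      have : ratB (.inl (-1)) * ratB (.inr 0) = ratB (.inr 0) + ratB (.inl (-1)) := by
        ext z
        have := one_sub_cleftPlane_ne_zero z.2
        have := cleftPlane_ne_zero z.2
        simp [ratB]
        field_simp
        ring
      rw [this]
      exact add_mem (ratB_mem_ratSpan _) (ratB_mem_ratSpan _)
    | succ l ih =>
      have : ratB (.inl (-1)) * ratB (.inr (l + 1)) =
          ratB (.inr (l + 1)) + ratB (.inl (-1)) * ratB (.inr l) := by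
        ext z
        have := one_sub_cleftPlane_ne_zero z.2
        have := cleftPlane_ne_zero z.2
        simp [ratB]
        field_simp
        ring
      rw [this]
      exact add_mem (ratB_mem_ratSpan _) ih

theorem one_sub_inv_mul_mem_ratSpan {g : CleftFun} (hg : g ∈ ratSpan) :
    ratB (.inr 0) * g ∈ ratSpan := by
  refine mul_mem_of_forall_range (fun r => ?_) hg
  rcases r with k | l
  -- This recursion is solved upwards for positive and downwards for negative exponents.
  · have h1 : ∀ k : ℤ, ratB (.inr 0) * ratB (.inl (k + 1)) =
        ratB (.inr 0) * ratB (.inl k) - ratB (.inl k) := fun k => by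
      ext z
      have := one_sub_cleftPlane_ne_zero z.2
      simp [ratB, zpow_add₀ (cleftPlane_ne_zero z.2)]
      field_simp
      ring
    induction k using Int.induction_on with
    | zero => rw [ratB_zero, mul_one]; exact ratB_mem_ratSpan _
    | succ k ih => rw [h1]; exact sub_mem ih (ratB_mem_ratSpan _)
    | pred k ih =>
      have := h1 (-(k : ℤ) - 1)
      rw [sub_add_cancel] at this
      rw [eq_add_of_sub_eq this.symm]
      exact add_mem ih (ratB_mem_ratSpan _)
  · have : ratB (.inr 0) * ratB (.inr l) = ratB (.inr (l + 1)) := by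
      ext z
      simp [ratB, pow_succ]
    rw [this]
    exact ratB_mem_ratSpan _

theorem mul_mem_ratSpan {f g : CleftFun} (hf : f ∈ rationalAlg) (hg : g ∈ ratSpan) :
    f * g ∈ ratSpan := by
  induction hf using Algebra.adjoin_induction generalizing g with
  | mem f hf =>
    rcases hf with rfl | rfl | rfl
    · simpa [ratB_inl] using z_mul_mem_ratSpan hg
    · simpa [ratB_inl] using z_inv_mul_mem_ratSpan hg
    · simpa [ratB_inr] using one_sub_inv_mul_mem_ratSpan hg
  | algebraMap c =>
    rw [← Algebra.smul_def]
    exact Submodule.smul_mem _ _ hg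
  | add f₁ f₂ _ _ h₁ h₂ => rw [add_mul]; exact add_mem (h₁ hg) (h₂ hg)
  | mul f₁ f₂ _ _ h₁ h₂ => rw [mul_assoc]; exact h₁ (h₂ hg)

theorem ratSpan_eq : ratSpan = Subalgebra.toSubmodule rationalAlg := by
  apply le_antisymm
  · rw [ratSpan, Submodule.span_le]
    rintro _ ⟨r, rfl⟩
    exact ratB_mem r
  · intro f hf
    have := mul_mem_ratSpan hf (ratB_mem_ratSpan (.inl 0))
    rwa [ratB_zero, mul_one] at this

/-! ### The polylogarithms span an algebra, also spanned by the products `ℓ Li_{x₀^n}` -/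

theorem polylogHom_word_length (u : XWord) :
    polylogHom (NCSeries.word u) u.length = polylog u := by
  rw [polylogHom, Finset.sum_eq_single u.get]
  · simp [NCSeries.word]
  · intro v _ hv
    rw [NCSeries.word, NCSeries.coeff_ofCoeff, if_neg, zero_smul]
    intro h
    exact hv (List.ofFn_injective (by rw [h, List.ofFn_get]))
  · simp

theorem polylogHom_word_of_ne {u : XWord} {n : ℕ} (h : n ≠ u.length) :
    polylogHom (NCSeries.word u) n = 0 := by
  refine Finset.sum_eq_zero fun _ _ => ?_
  rw [NCSeries.word, NCSeries.coeff_ofCoeff, if_neg, zero_smul]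
  rintro rfl
  simp at h

/-- The span of the polylogarithms. -/
def polylogSpan : Submodule ℂ CleftFun := Submodule.span ℂ (Set.range polylog)

theorem polylogHom_mem (T : NCSeries) (n : ℕ) : polylogHom T n ∈ polylogSpan :=
  sum_mem fun _ _ => Submodule.smul_mem _ _ (Submodule.subset_span ⟨_, rfl⟩)

theorem polylog_mul_polylog_mem (u v : XWord) : polylog u * polylog v ∈ polylogSpan := by
  have h : polylogHom (NCSeries.word u * NCSeries.word v) (u.length + v.length) =
      polylog u * polylog v := by
    rw [polylogHom_mul, Finset.sum_eq_single (u.length, v.length), polylogHom_word_length,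
      polylogHom_word_length]
    · rintro ⟨p, q⟩ hpq hne
      have hpq := Finset.HasAntidiagonal.mem_antidiagonal.1 hpq
      by_cases hp : p = u.length
      · have hq : q ≠ v.length := fun hq => hne (by rw [hp, hq])
        rw [polylogHom_word_of_ne hq, mul_zero]
      · rw [polylogHom_word_of_ne hp, zero_mul]
    · intro h
      simp at h
  rw [← h]
  exact polylogHom_mem _ _

theorem polylogSpan_mul_le : polylogSpan * polylogSpan ≤ polylogSpan := by
  rw [polylogSpan, Submodule.span_mul_span, Submodule.span_le]
  rintro _ ⟨_, ⟨u, rfl⟩, _, ⟨v, rfl⟩, rfl⟩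
  exact polylog_mul_polylog_mem u v

theorem polylogL_mem (j : LIndex) : polylogL j ∈ polylogSpan := by
  rcases j with ⟨_ | u, n⟩
  · rw [polylogL, polylogHead, one_mul]
    exact Submodule.subset_span ⟨_, rfl⟩
  · exact polylog_mul_polylog_mem _ _

theorem polylogL_some (u : XWord) (n : ℕ) :
    polylogL (some u, n) = (n.factorial : ℂ)⁻¹ • (polylogAux u 0 * cleftLog ^ n) := by
  rw [← polylog_append_one, polylogL, polylogHead, polylog_replicate_zero, List.replicate_zero,
    mul_smul_comm]

theorem polylogL_some_mul_cleftLog (u : XWord) (n : ℕ) :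
    polylogL (some u, n) * cleftLog = ((n : ℂ) + 1) • polylogL (some u, n + 1) := by
  ext z
  have h1 := cast_add_one_ne_zero n
  have h2 : (n.factorial : ℂ) ≠ 0 := by exact_mod_cast n.factorial_ne_zero
  simp only [polylogL_some, Pi.smul_apply, Pi.mul_apply, Pi.pow_apply, smul_eq_mul,
    Nat.factorial_succ]
  push_cast
  field_simp
  ring

/-- The span of the products `Li_{u x₁} Li_{x₀^n}`. -/
def singularSpan : Submodule ℂ CleftFun :=
  Submodule.span ℂ (Set.range fun p : XWord × ℕ => polylogL (some p.1, p.2))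

/-- The recursion defining `polylogAux` uses only multiplication by `log`, which raises the exponent
in `Li_{u x₁} Li_{x₀^n}` up to a scalar. -/
theorem polylogAux_mem (u : XWord) (n : ℕ) : polylogAux u n ∈ singularSpan := by
  induction n generalizing u with
  | zero => exact Submodule.subset_span ⟨(u, 0), by simp [polylogL_some]⟩
  | succ n ih =>
    rw [polylogAux]
    refine Submodule.smul_mem _ _ (sub_mem ?_ (sum_mem fun i _ => ih _))
    rw [mul_comm]
    refine mul_mem_of_forall_range (fun p => ?_) (ih u)
    rw [mul_comm, polylogL_some_mul_cleftLog]
    exact Submodule.smul_mem _ _ (Submodule.subset_span ⟨(p.1, p.2 + 1), rfl⟩)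

/-- The same recursion solved for the product with `log`. It is needed because a primitive against
`dz/z` is at hand for words: prefix the letter `x₀`. -/
theorem polylogL_some_mem_span_polylogAux (u : XWord) (n : ℕ) :
    polylogL (some u, n) ∈
      Submodule.span ℂ (Set.range fun p : XWord × ℕ => polylogAux p.1 p.2) := by
  induction n with
  | zero => exact Submodule.subset_span ⟨(u, 0), by simp [polylogL_some]⟩
  | succ n ih =>
    rw [← inv_smul_smul₀ (cast_add_one_ne_zero n) (polylogL _), ← polylogL_some_mul_cleftLog,
      mul_comm]
    refine Submodule.smul_mem _ _ (mul_mem_of_forall_range (fun p => ?_) ih)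
    rw [mul_comm, eq_add_of_sub_eq (polylogAux_succ_smul p.1 p.2).symm]
    exact add_mem (Submodule.smul_mem _ _ (Submodule.subset_span ⟨(p.1, p.2 + 1), rfl⟩))
      (sum_mem fun i _ => Submodule.subset_span ⟨(p.1.insertIdx i 0, p.2), rfl⟩)

theorem span_polylogL : Submodule.span ℂ (Set.range polylogL) = polylogSpan := by
  apply le_antisymm
  · rw [Submodule.span_le]
    rintro _ ⟨j, rfl⟩
    exact polylogL_mem j
  · rw [polylogSpan, Submodule.span_le]
    rintro _ ⟨w, rfl⟩
    rcases word_cases w with ⟨n, rfl⟩ | ⟨u, n, rfl⟩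
    · exact Submodule.subset_span ⟨(none, n), by rw [polylogL, polylogHead, one_mul]⟩
    · rw [polylog_append_one]
      refine Submodule.span_mono ?_ (polylogAux_mem u n)
      rintro _ ⟨p, rfl⟩
      exact ⟨_, rfl⟩

theorem span_polylogB : Submodule.span ℂ (Set.range polylogB) = ratSpan * polylogSpan := by
  rw [← span_polylogL, ratSpan, Submodule.span_mul_span]
  congr 1
  ext f
  constructor
  · rintro ⟨⟨r, j⟩, rfl⟩
    rw [polylogB_eq]
    exact Set.mul_mem_mul ⟨r, rfl⟩ ⟨j, rfl⟩
  · rintro ⟨_, ⟨r, rfl⟩, _, ⟨j, rfl⟩, rfl⟩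
    exact ⟨(r, j), polylogB_eq r j⟩

theorem polylog_mem_polylogAlg (w : XWord) : polylog w ∈ polylogAlg :=
  Algebra.subset_adjoin (R := rationalAlg) ⟨w, rfl⟩

theorem mem_polylogAlg_of_mem_rationalAlg {f : CleftFun} (hf : f ∈ rationalAlg) :
    f ∈ polylogAlg :=
  (Algebra.adjoin rationalAlg (Set.range polylog)).algebraMap_mem ⟨f, hf⟩

theorem polylogAlg_induction {P : CleftFun → Prop} (hpoly : ∀ w, P (polylog w))
    (hrat : ∀ f ∈ rationalAlg, P f) (hadd : ∀ f g, P f → P g → P (f + g))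
    (hmul : ∀ f g, P f → P g → P (f * g)) {f : CleftFun} (hf : f ∈ polylogAlg) : P f := by
  have hf' : f ∈ Algebra.adjoin rationalAlg (Set.range polylog) := hf
  clear hf
  induction hf' using Algebra.adjoin_induction with
  | mem f hf =>
    obtain ⟨w, rfl⟩ := hf
    exact hpoly w
  | algebraMap r => exact hrat _ r.2
  | add f g _ _ hf hg => exact hadd f g hf hg
  | mul f g _ _ hf hg => exact hmul f g hf hg

theorem span_polylogB_eq_polylogAlg :
    Submodule.span ℂ (Set.range polylogB) = Subalgebra.toSubmodule polylogAlg := by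
  have h1 : (1 : CleftFun) ∈ ratSpan := ratB_zero ▸ ratB_mem_ratSpan (.inl 0)
  have h2 : (1 : CleftFun) ∈ polylogSpan := polylog_nil ▸ Submodule.subset_span ⟨_, rfl⟩
  have hR : ratSpan * ratSpan ≤ ratSpan := by
    rw [ratSpan_eq, Subalgebra.mul_toSubmodule, sup_idem]
  apply le_antisymm
  · rw [Submodule.span_le]
    rintro _ ⟨⟨r, j⟩, rfl⟩
    rw [polylogB_eq]
    have h : polylogHead j.1 ∈ polylogAlg := by
      rcases j with ⟨_ | u, n⟩
      · exact one_mem _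
      · exact polylog_mem_polylogAlg _
    exact polylogAlg.mul_mem (mem_polylogAlg_of_mem_rationalAlg (ratB_mem r))
      (polylogAlg.mul_mem h (polylog_mem_polylogAlg _))
  · intro f hf
    rw [span_polylogB]
    refine polylogAlg_induction (fun w => ?_) (fun f hf => ?_) (fun f g hf hg => add_mem hf hg)
      (fun f g hf hg => ?_) hf
    · rw [← one_mul (polylog w)]
      exact Submodule.mul_mem_mul h1 (Submodule.subset_span ⟨w, rfl⟩)
    · rw [← mul_one f]
      exact Submodule.mul_mem_mul (by rw [ratSpan_eq]; exact hf) h2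
    · have := Submodule.mul_mem_mul hf hg
      rw [mul_mul_mul_comm] at this
      exact mul_le_mul' hR polylogSpan_mul_le this

/-! ### The integration operators on the polylogarithms -/

theorem continuousOn_extendCleft {f : CleftFun} (hf : Continuous f) :
    ContinuousOn (extendCleft f) cleftPlane := by
  rw [continuousOn_iff_continuous_domRestrict]
  convert hf using 1
  ext z
  exact extendCleft_apply f z

theorem segInt_eq {f F : CleftFun} {g : ℂ → ℂ} {i : Fin 2} (hf : Continuous f)
    (hg : ∀ z : cleftPlane, g z = cleftForm i z) (hF : HasCleftDeriv F (cleftForm i * f))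
    {a : ℝ} (h0 : 0 < a) (h1 : a < 1) (z : cleftPlane) :
    segInt f g a z = F z - extendCleft F a := by
  have hmem : ∀ t ∈ Set.uIcc (0 : ℝ) 1, (a : ℂ) + t * (z - a) ∈ cleftPlane := fun t ht =>
    segment_mem_cleftPlane h0 h1 z.2 (by rwa [Set.uIcc_of_le zero_le_one] at ht)
  have hgc : ContinuousOn g cleftPlane := by
    have : Continuous (cleftForm i) := by
      unfold cleftForm
      split_ifs
      · exact continuous_subtype_val.inv₀ fun z => cleftPlane_ne_zero z.2
      · exact (continuous_const.sub continuous_subtype_val).inv₀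
          fun z => one_sub_cleftPlane_ne_zero z.2
    rw [continuousOn_iff_continuous_domRestrict]
    convert this using 1
    ext z
    exact hg z
  have hl : ContinuousOn (fun t : ℝ => (a : ℂ) + t * (z - a)) (Set.uIcc (0 : ℝ) 1) := by
    fun_prop
  rw [segInt, intervalIntegral.integral_eq_sub_of_hasDerivAt
    (f := fun t : ℝ => extendCleft F (a + t * (z - a)))]
  · simp [extendCleft_apply]
  · intro t ht
    have hd := hF ⟨_, hmem t ht⟩
    have h2 : HasDerivAt (fun t : ℂ => (a : ℂ) + t * (z - a)) (z - a) t := by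
      simpa using ((hasDerivAt_id (t : ℂ)).mul_const ((z : ℂ) - a)).const_add (a : ℂ)
    refine (hd.comp (t : ℂ) h2).comp_ofReal.congr_deriv ?_
    rw [extendCleft_of_mem _ (hmem t ht), Pi.mul_apply, ← hg]
    ring
  · exact ((((continuousOn_extendCleft hf).comp hl hmem).mul (hgc.comp hl hmem)).mul
      continuousOn_const).intervalIntegrable

/-- The integral from `ε` is `F(z) - F(ε)`, so for a primitive tending to `0` at the base point the
finite part is a true limit. -/
theorem intFromZero_eq {f F : CleftFun} {g : ℂ → ℂ} {i : Fin 2} (hf : Continuous f)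
    (hg : ∀ z : cleftPlane, g z = cleftForm i z) (hF : HasCleftDeriv F (cleftForm i * f))
    (h0 : Tendsto (fun ε : ℝ => extendCleft F ε) (𝓝[>] 0) (𝓝 0)) : intFromZero f g = F := by
  ext z
  refine finitePart_eq_of_tendsto ?_
  have h : Tendsto (fun ε : ℝ => F z - extendCleft F ε) (𝓝[>] 0) (𝓝 (F z)) := by
    simpa using (tendsto_const_nhds (x := F z)).sub h0
  refine h.congr' ?_
  filter_upwards [Ioo_mem_nhdsGT (zero_lt_one' ℝ)] with ε hε
  exact (segInt_eq hf hg hF hε.1 hε.2 z).symm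

theorem intFromOne_eq {f F : CleftFun} {g : ℂ → ℂ} {i : Fin 2} (hf : Continuous f)
    (hg : ∀ z : cleftPlane, g z = cleftForm i z) (hF : HasCleftDeriv F (cleftForm i * f))
    (h0 : Tendsto (fun ε : ℝ => extendCleft F ((1 - ε : ℝ) : ℂ)) (𝓝[>] 0) (𝓝 0)) :
    intFromOne f g = F := by
  ext z
  refine finitePart_eq_of_tendsto ?_
  have h : Tendsto (fun ε : ℝ => F z - extendCleft F ((1 - ε : ℝ) : ℂ)) (𝓝[>] 0) (𝓝 (F z)) := by
    simpa using (tendsto_const_nhds (x := F z)).sub h0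
  refine h.congr' ?_
  filter_upwards [Ioo_mem_nhdsGT (zero_lt_one' ℝ)] with ε hε
  rw [← segInt_eq hf hg hF (a := 1 - ε) (by linarith [hε.2]) (by linarith [hε.1]) z]
  push_cast
  rfl

theorem continuous_polylog (w : XWord) : Continuous (polylog w) := by
  cases w with
  | nil => rw [polylog_nil]; exact continuous_one
  | cons i w => exact (hasCleftDeriv_polylog_cons i w).continuous

theorem iota1_polylog (w : XWord) : iota1 (polylog w) = polylog (1 :: w) :=
  intFromZero_eq (i := 1) (continuous_polylog w) (fun z => by simp [cleftForm])
    (hasCleftDeriv_polylog_cons 1 w) (vanishesAtZero_polylog (by simp)).tendsto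

theorem iota0_linearCombination (c : BIndex →₀ ℂ) :
    iota0 (Finsupp.linearCombination ℂ polylogB c) = c.sum fun b a => a • iota0B b := by
  have hmem : Finsupp.linearCombination ℂ polylogB c ∈ Submodule.span ℂ (Set.range polylogB) := by
    rw [← Finsupp.range_linearCombination]
    exact ⟨c, rfl⟩
  rw [iota0, dif_pos ⟨linearIndependent_polylogB, hmem⟩]
  congr 1
  exact LinearIndependent.repr_eq _ rfl

theorem iota0_polylogB (b : BIndex) : iota0 (polylogB b) = iota0B b := by
  simpa using iota0_linearCombination (Finsupp.single b 1)

theorem polylogB_inl_zero (j : LIndex) : polylogB (.inl 0, j) = polylogL j := by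
  rw [polylogB_eq, ratB_zero, one_mul]

/-- Here the index is `0`, so the integral starts at `1`, where the primitive `log^(n+1)/(n+1)!`
vanishes. -/
theorem iota0_polylog_replicate (n : ℕ) :
    iota0 (polylog (List.replicate n 0)) = polylog (0 :: List.replicate n 0) := by
  have e : polylog (List.replicate n 0) = polylogB (.inl 0, none, n) := by
    rw [polylogB_inl_zero, polylogL, polylogHead, one_mul]
  rw [e, iota0_polylogB, iota0B, if_neg (by simp [indB]), ← e]
  refine intFromOne_eq (i := 0) (continuous_polylog _) (fun z => by simp [cleftForm])
    (hasCleftDeriv_polylog_cons 0 _) ?_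
  rw [← List.replicate_succ, polylog_replicate_zero]
  have h : Tendsto (fun ε : ℝ => (((n + 1).factorial : ℂ))⁻¹ *
      ((Real.log (1 - ε) : ℝ) : ℂ) ^ (n + 1)) (𝓝[>] 0) (𝓝 0) := by
    have h1 : Tendsto (fun ε : ℝ => Real.log (1 - ε)) (𝓝 0) (𝓝 0) := by
      have : ContinuousAt (fun ε : ℝ => Real.log (1 - ε)) 0 :=
        ContinuousAt.log (by fun_prop) (by norm_num)
      simpa [ContinuousAt] using this
    have h2 := ((Complex.continuous_ofReal.tendsto 0).comp h1).mono_left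
      (nhdsWithin_le_nhds (s := Set.Ioi 0))
    simpa using (h2.pow (n + 1)).const_mul (((n + 1).factorial : ℂ))⁻¹
  refine h.congr' ?_
  filter_upwards [Ioo_mem_nhdsGT (zero_lt_one' ℝ)] with ε hε
  rw [extendCleft_of_mem _ (ofReal_mem_cleftPlane (by linarith [hε.2]) (by linarith [hε.1]))]
  simp only [Pi.smul_apply, Pi.pow_apply, cleftLog, smul_eq_mul]
  rw [Complex.ofReal_log (by linarith [hε.2])]

theorem exists_primitive_polylogL_some (u : XWord) (n : ℕ) :
    ∃ F, HasCleftDeriv F (cleftForm 0 * polylogL (some u, n)) ∧ VanishesAtZero F := by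
  have h := polylogL_some_mem_span_polylogAux u n
  generalize polylogL (some u, n) = f at h ⊢
  induction h using Submodule.span_induction with
  | mem f hf =>
    obtain ⟨⟨u, n⟩, rfl⟩ := hf
    refine ⟨polylog (0 :: (u ++ 1 :: List.replicate n 0)), ?_, vanishesAtZero_polylog (by simp)⟩
    have := hasCleftDeriv_polylog_cons 0 (u ++ 1 :: List.replicate n 0)
    rwa [polylog_append_one] at this
  | zero => exact ⟨0, by simpa using HasCleftDeriv.zero, VanishesAtZero.zero⟩
  | add f g _ _ hf hg =>
    obtain ⟨F, hF, hF0⟩ := hf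
    obtain ⟨G, hG, hG0⟩ := hg
    exact ⟨F + G, by rw [mul_add]; exact hF.add hG, hF0.add hG0⟩
  | smul c f _ hf =>
    obtain ⟨F, hF, hF0⟩ := hf
    exact ⟨c • F, by rw [mul_smul_comm]; exact hF.smul c, hF0.smul c⟩

theorem hasCleftDeriv_iota0B_some (u : XWord) (n : ℕ) :
    HasCleftDeriv (iota0B (.inl 0, some u, n)) (cleftForm 0 * polylogL (some u, n)) ∧
      VanishesAtZero (iota0B (.inl 0, some u, n)) := by
  obtain ⟨F, hF, hF0⟩ := exists_primitive_polylogL_some u n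
  have e : iota0B (.inl 0, some u, n) = F := by
    rw [iota0B, if_pos (by simp [indB]), polylogB_inl_zero]
    refine intFromZero_eq (i := 0) ?_ (fun z => by simp [cleftForm]) hF hF0.tendsto
    exact (continuous_polylog _).mul (continuous_polylog _)
  rw [e]
  exact ⟨hF, hF0⟩

/-- Expanded in `ℬ`, the function involves only elements `Li_{v x₁} Li_{x₀^m}`, whose index is at
least `1`. Both sides are therefore primitives of the same function that vanish at `0`. -/
theorem iota0_polylogAux (u : XWord) (n : ℕ) :
    iota0 (polylogAux u n) = polylog (0 :: (u ++ 1 :: List.replicate n 0)) := by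
  obtain ⟨c, hc⟩ := (Finsupp.mem_span_range_iff_exists_finsupp).1 (polylogAux_mem u n)
  set e : XWord × ℕ → BIndex := fun p => (.inl 0, some p.1, p.2)
  have h1 : Finsupp.linearCombination ℂ polylogB (c.mapDomain e) = polylogAux u n := by
    rw [Finsupp.linearCombination_mapDomain, Finsupp.linearCombination_apply, ← hc]
    refine Finsupp.sum_congr fun p _ => ?_
    simp only [Function.comp_apply, e, polylogB_inl_zero]
  have h2 : iota0 (polylogAux u n) = ∑ p ∈ c.support, c p • iota0B (e p) := by
    rw [← h1, iota0_linearCombination, Finsupp.sum_mapDomain_index (by simp)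
      (fun _ _ _ => add_smul _ _ _)]
    rfl
  have h3 : HasCleftDeriv (iota0 (polylogAux u n)) (cleftForm 0 * polylogAux u n) := by
    rw [h2, ← hc, Finsupp.sum, Finset.mul_sum]
    refine HasCleftDeriv.sum _ fun p _ => ?_
    rw [mul_smul_comm]
    exact (hasCleftDeriv_iota0B_some p.1 p.2).1.smul _
  have h4 : VanishesAtZero (iota0 (polylogAux u n)) := by
    rw [h2]
    exact VanishesAtZero.sum _ fun p _ => (hasCleftDeriv_iota0B_some p.1 p.2).2.smul _
  have h5 := hasCleftDeriv_polylog_cons 0 (u ++ 1 :: List.replicate n 0)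
  rw [polylog_append_one] at h5
  refine sub_eq_zero.1 (eq_zero_of_hasCleftDeriv_zero (κ := 0) (n := 0) ?_ ?_)
  · simpa using h3.sub h5
  · simpa using h4.sub (vanishesAtZero_polylog (by simp))

theorem imOp_one (w : XWord) : imOp w 1 = polylog w := by
  induction w with
  | nil => rw [imOp, polylog_nil]
  | cons i w ih =>
    rw [imOp, ih]
    by_cases hi : i = 0
    · rw [if_pos hi, hi]
      rcases word_cases w with ⟨n, rfl⟩ | ⟨u, n, rfl⟩
      · exact iota0_polylog_replicate n
      · rw [polylog_append_one]
        exact iota0_polylogAux u n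
    · rw [if_neg hi, fin_two_eq_one hi, iota1_polylog]

theorem imHom_one (T : NCSeries) (n : ℕ) : imHom T n 1 = polylogHom T n := by
  simp only [imHom, imOp_one, polylogHom]

/-! ### Normally convergent series -/

/-- The series `∑ₙ ∑_{|w| = n} ⟨T | w⟩ Li_w` converges normally on the compact sets. -/
def IsNormal (T : NCSeries) : Prop :=
  ∀ K : Set cleftPlane, IsCompact K →
    ∃ u : ℕ → ℝ, Summable u ∧ ∀ n, ∀ z ∈ K, ‖polylogHom T n z‖ ≤ u n

theorem isNormal_of_eventually_zero {T : NCSeries} {N : ℕ} (h : ∀ n ≥ N, polylogHom T n = 0)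
    (hc : ∀ n, Continuous (polylogHom T n)) : IsNormal T := by
  intro K hK
  choose C hC using fun n => hK.exists_bound_of_continuousOn (hc n).continuousOn
  refine ⟨fun n => if n < N then C n else 0, ?_, fun n z hz => ?_⟩
  · refine summable_of_ne_finset_zero (s := Finset.range N) fun n hn => ?_
    rw [Finset.mem_range] at hn
    rw [if_neg hn]
  · show ‖polylogHom T n z‖ ≤ if n < N then C n else 0
    split_ifs with hn
    · exact hC n z hz
    · rw [h n (not_lt.1 hn)]
      simp

theorem continuous_polylogHom (T : NCSeries) (n : ℕ) : Continuous (polylogHom T n) := by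
  have e : polylogHom T n = fun z =>
      ∑ v : Fin n → Fin 2, (T.coeff (List.ofFn v) • polylog (List.ofFn v)) z := by
    ext z
    simp [polylogHom]
  rw [e]
  exact continuous_finsetSum _ fun v _ =>
    (continuous_polylog (List.ofFn v)).const_smul (T.coeff (List.ofFn v))

theorem isNormal_word (w : XWord) : IsNormal (NCSeries.word w) :=
  isNormal_of_eventually_zero (N := w.length + 1)
    (fun n hn => polylogHom_word_of_ne (by omega)) (continuous_polylogHom _)

theorem IsNormal.add {S T : NCSeries} (hS : IsNormal S) (hT : IsNormal T) : IsNormal (S + T) := by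
  intro K hK
  obtain ⟨u, hu, hu'⟩ := hS K hK
  obtain ⟨v, hv, hv'⟩ := hT K hK
  refine ⟨fun n => u n + v n, hu.add hv, fun n z hz => ?_⟩
  rw [polylogHom_add]
  exact (norm_add_le _ _).trans (add_le_add (hu' n z hz) (hv' n z hz))

theorem IsNormal.smul (c : ℂ) {T : NCSeries} (hT : IsNormal T) : IsNormal (c • T) := by
  intro K hK
  obtain ⟨u, hu, hu'⟩ := hT K hK
  refine ⟨fun n => ‖c‖ * u n, hu.mul_left _, fun n z hz => ?_⟩
  rw [polylogHom_smul, Pi.smul_apply, norm_smul]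
  exact mul_le_mul_of_nonneg_left (hu' n z hz) (norm_nonneg c)

/-- The Cauchy product of the two majorants is a majorant, by `polylogHom_mul`. -/
theorem IsNormal.mul {S T : NCSeries} (hS : IsNormal S) (hT : IsNormal T) : IsNormal (S * T) := by
  intro K hK
  obtain ⟨u, hu, hu'⟩ := hS K hK
  obtain ⟨v, hv, hv'⟩ := hT K hK
  refine ⟨fun n => ‖∑ p ∈ Finset.HasAntidiagonal.antidiagonal n, u p.1 * v p.2‖,
    summable_norm_sum_mul_antidiagonal_of_summable_norm hu.norm hv.norm, fun n z hz => ?_⟩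
  refine le_trans ?_ (le_abs_self _)
  rw [polylogHom_mul, Finset.sum_apply]
  refine (norm_sum_le _ _).trans (Finset.sum_le_sum fun p _ => ?_)
  rw [Pi.mul_apply, norm_mul]
  exact mul_le_mul (hu' _ z hz) (hv' _ z hz) (norm_nonneg _) ((norm_nonneg _).trans (hu' _ z hz))

theorem IsNormal.summable_norm {T : NCSeries} (hT : IsNormal T) (z : cleftPlane) :
    Summable fun n => ‖polylogHom T n z‖ := by
  obtain ⟨u, hu, hu'⟩ := hT {z} isCompact_singleton
  exact Summable.of_nonneg_of_le (fun _ => norm_nonneg _) (fun n => hu' n z rfl) hu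

/-- The algebra of the series `T` for which `∑ₙ ∑_{|w| = n} ⟨T | w⟩ Li_w` converges normally. -/
def normalAlg : Subalgebra ℂ NCSeries where
  carrier := {T | IsNormal T}
  mul_mem' hS hT := hS.mul hT
  add_mem' hS hT := hS.add hT
  algebraMap_mem' c := by
    rw [Algebra.algebraMap_eq_smul_one]
    exact (isNormal_word []).smul c

/-- The sum `∑ₙ ∑_{|w| = n} ⟨T | w⟩ Li_w`. -/
def polylogSum (T : NCSeries) : CleftFun := fun z => ∑' n, polylogHom T n z

theorem polylogSum_mul {S T : NCSeries} (hS : IsNormal S) (hT : IsNormal T) :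
    polylogSum (S * T) = polylogSum S * polylogSum T := by
  ext z
  rw [Pi.mul_apply, polylogSum, polylogSum, polylogSum,
    tsum_mul_tsum_eq_tsum_sum_antidiagonal_of_summable_norm (hS.summable_norm z)
      (hT.summable_norm z)]
  refine tsum_congr fun n => ?_
  rw [polylogHom_mul, Finset.sum_apply]
  rfl

theorem polylogSum_add {S T : NCSeries} (hS : IsNormal S) (hT : IsNormal T) :
    polylogSum (S + T) = polylogSum S + polylogSum T := by
  ext z
  rw [Pi.add_apply, polylogSum, polylogSum, polylogSum,
    ← (hS.summable_norm z).of_norm.tsum_add (hT.summable_norm z).of_norm]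
  refine tsum_congr fun n => ?_
  rw [polylogHom_add]
  rfl

theorem polylogSum_smul (c : ℂ) (T : NCSeries) : polylogSum (c • T) = c • polylogSum T := by
  ext z
  rw [Pi.smul_apply, polylogSum, polylogSum, smul_eq_mul, ← tsum_mul_left]
  refine tsum_congr fun n => ?_
  rw [polylogHom_smul]
  rfl

theorem polylogSum_word (w : XWord) : polylogSum (NCSeries.word w) = polylog w := by
  ext z
  rw [polylogSum, tsum_eq_single w.length, polylogHom_word_length]
  intro n hn
  rw [polylogHom_word_of_ne hn]
  rfl

/-- `T ↦ ∑ₙ ∑_{|w| = n} ⟨T | w⟩ Li_w` as a morphism of algebras. -/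
def polylogSumHom : normalAlg →ₐ[ℂ] CleftFun :=
  AlgHom.ofLinearMap
    { toFun := fun T => polylogSum T
      map_add' := fun S T => polylogSum_add S.2 T.2
      map_smul' := fun c T => polylogSum_smul c T }
    ((polylogSum_word []).trans polylog_nil)
    fun S T => polylogSum_mul S.2 T.2

theorem IsNormal.hasIm {T : NCSeries} (hT : IsNormal T) : HasIm T 1 (polylogSum T) := by
  have : LocallyCompactSpace cleftPlane := isOpen_cleftPlane.locallyCompactSpace
  rw [HasIm, tendstoLocallyUniformly_iff_forall_isCompact]
  intro K hK
  obtain ⟨u, hu, hu'⟩ := hT K hK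
  refine (tendstoUniformlyOn_tsum_nat hu fun n z hz => hu' n z hz).congr
    (Eventually.of_forall fun N z _ => ?_)
  simp [imHom_one]

/-! ### The Kleene stars of the letters -/

theorem isNormal_of_exp {T : NCSeries} {g : CleftFun} (hg : Continuous g)
    (h : ∀ n, polylogHom T n = (n.factorial : ℂ)⁻¹ • g ^ n) :
    IsNormal T ∧ polylogSum T = fun z => Complex.exp (g z) := by
  constructor
  · intro K hK
    obtain ⟨C, hC⟩ := hK.exists_bound_of_continuousOn hg.continuousOn
    refine ⟨fun n => C ^ n / n.factorial, Real.summable_pow_div_factorial C, fun n z hz => ?_⟩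
    rw [h, Pi.smul_apply, Pi.pow_apply, norm_smul, norm_pow, norm_inv, Complex.norm_natCast,
      ← div_eq_inv_mul]
    simp only
    gcongr
    exact hC z hz
  · ext z
    rw [polylogSum, Complex.exp_eq_exp_ℂ, NormedSpace.exp_eq_tsum_div]
    refine tsum_congr fun n => ?_
    rw [h, Pi.smul_apply, Pi.pow_apply, smul_eq_mul, div_eq_inv_mul]

/-- In the star of a multiple of one letter, only the powers of that letter have a nonzero
coefficient. -/
theorem polylogHom_star {a : Fin 2 → ℂ} {i : Fin 2} (ha : ∀ j, j ≠ i → a j = 0) (n : ℕ) :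
    polylogHom (NCSeries.star a) n = a i ^ n • polylog (List.replicate n i) := by
  rw [polylogHom, Finset.sum_eq_single fun _ => i]
  · simp [NCSeries.star]
  · intro v _ hv
    obtain ⟨k, hk⟩ := Function.ne_iff.1 hv
    rw [NCSeries.star, NCSeries.coeff_ofCoeff, List.prod_eq_zero, zero_smul]
    exact List.mem_map.2 ⟨v k, List.mem_ofFn.2 ⟨k, rfl⟩, ha _ hk⟩
  · simp

theorem star_zero_spec (c : ℂ) : IsNormal (NCSeries.star ![c, 0]) ∧
    polylogSum (NCSeries.star ![c, 0]) = fun z : cleftPlane =>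
      Complex.exp (c * Complex.log z) := by
  refine isNormal_of_exp (g := c • cleftLog) (hasCleftDeriv_cleftLog.continuous.const_smul c)
    fun n => ?_
  rw [polylogHom_star (i := 0) (by simp [Fin.forall_fin_two]), polylog_replicate_zero, smul_pow,
    smul_comm]
  rfl

/-- `z ↦ -log (1 - z)` on the cleft plane. -/
def negLogOneSub : CleftFun := fun z => -Complex.log (1 - z)

theorem hasCleftDeriv_negLogOneSub : HasCleftDeriv negLogOneSub (cleftForm 1) := by
  have h := HasCleftDeriv.of_hasDerivAt (F := fun z => -Complex.log (1 - z))
    (f := fun z => (1 - z)⁻¹) fun z hz => by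
      have := ((hasDerivAt_id z).const_sub 1).clog (mem_cleftPlane_iff.1 hz).2
      exact this.neg.congr_deriv (by simp [neg_div])
  exact h

theorem vanishesAtZero_negLogOneSub : VanishesAtZero negLogOneSub := by
  refine VanishesAtZero.of_differentiableAt (F := fun z => -Complex.log (1 - z)) ?_ (by simp)
  have := ((hasDerivAt_id (0 : ℂ)).const_sub 1).clog (by simp)
  exact this.differentiableAt.neg

theorem VanishesAtZero.pow {f : CleftFun} (hf : VanishesAtZero f) (n : ℕ) :
    VanishesAtZero (f ^ (n + 1)) := by
  induction n with
  | zero => simpa using hf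
  | succ n ih => rw [pow_succ]; exact ih.mul hf

theorem polylog_replicate_one (n : ℕ) :
    polylog (List.replicate n 1) = (n.factorial : ℂ)⁻¹ • negLogOneSub ^ n := by
  induction n with
  | zero => simp [polylog_nil]
  | succ n ih =>
    refine sub_eq_zero.1 (eq_zero_of_hasCleftDeriv_zero (κ := 0) (n := 0) ?_ ?_)
    · have h1 := hasCleftDeriv_polylog_cons 1 (List.replicate n 1)
      have h2 := (hasCleftDeriv_negLogOneSub.pow n).smul (((n + 1).factorial : ℂ))⁻¹
      refine cast ?_ (h1.sub h2)
      rw [List.replicate_succ]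
      congr 1
      rw [ih]
      ext z
      have h1 := cast_add_one_ne_zero n
      have h2 : (n.factorial : ℂ) ≠ 0 := by exact_mod_cast n.factorial_ne_zero
      simp only [Pi.smul_apply, Pi.mul_apply, Pi.pow_apply, Pi.sub_apply, Pi.zero_apply,
        smul_eq_mul, Nat.factorial_succ]
      push_cast
      field_simp
      ring
    · rw [zero_smul, sub_zero]
      exact (vanishesAtZero_polylog (by simp)).sub ((vanishesAtZero_negLogOneSub.pow n).smul _)

theorem star_one_spec : IsNormal (NCSeries.star ![0, 1]) ∧
    polylogSum (NCSeries.star ![0, 1]) = fun z : cleftPlane =>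
      Complex.exp (-Complex.log (1 - z)) := by
  refine isNormal_of_exp (g := negLogOneSub) hasCleftDeriv_negLogOneSub.continuous fun n => ?_
  rw [polylogHom_star (i := 1) (by simp [Fin.forall_fin_two]), polylog_replicate_one]
  simp

theorem polylogSum_star_pos : polylogSum (NCSeries.star ![1, 0]) = fun z : cleftPlane => (z : ℂ) := by
  rw [(star_zero_spec 1).2]
  ext z
  rw [one_mul, Complex.exp_log (cleftPlane_ne_zero z.2)]

theorem polylogSum_star_neg :
    polylogSum (NCSeries.star ![-1, 0]) = fun z : cleftPlane => (z : ℂ)⁻¹ := by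
  rw [(star_zero_spec (-1)).2]
  ext z
  rw [neg_one_mul, Complex.exp_neg, Complex.exp_log (cleftPlane_ne_zero z.2)]

theorem polylogSum_star_one :
    polylogSum (NCSeries.star ![0, 1]) = fun z : cleftPlane => (1 - (z : ℂ))⁻¹ := by
  rw [star_one_spec.2]
  ext z
  rw [Complex.exp_neg, Complex.exp_log (one_sub_cleftPlane_ne_zero z.2)]

/-! ### The morphism -/

/-- The normal series with sum in `polylogAlg` form a subalgebra, so only the generators need to be
checked. -/
theorem starAlgebra_le :
    NCSeries.starAlgebra ≤ (polylogAlg.comap polylogSumHom).map normalAlg.val := by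
  have key : ∀ T (h : IsNormal T), polylogSum T ∈ polylogAlg →
      T ∈ (polylogAlg.comap polylogSumHom).map normalAlg.val := fun T h hT => ⟨⟨T, h⟩, hT, rfl⟩
  refine sup_le (sup_le (sup_le ?_ ?_) ?_) ?_ <;> refine Algebra.adjoin_le ?_
  · rintro _ rfl
    refine key _ (star_zero_spec 1).1 ?_
    rw [polylogSum_star_pos]
    exact mem_polylogAlg_of_mem_rationalAlg (Algebra.subset_adjoin (by simp))
  · rintro _ rfl
    refine key _ (star_zero_spec (-1)).1 ?_
    rw [polylogSum_star_neg]
    exact mem_polylogAlg_of_mem_rationalAlg (Algebra.subset_adjoin (by simp))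
  · rintro _ rfl
    refine key _ star_one_spec.1 ?_
    rw [polylogSum_star_one]
    exact mem_polylogAlg_of_mem_rationalAlg (Algebra.subset_adjoin (by simp))
  · rintro _ ⟨w, rfl⟩
    refine key _ (isNormal_word w) ?_
    rw [polylogSum_word]
    exact polylog_mem_polylogAlg w

theorem isNormal_of_mem_starAlgebra {T : NCSeries} (hT : T ∈ NCSeries.starAlgebra) :
    IsNormal T := by
  obtain ⟨S, _, rfl⟩ := starAlgebra_le hT
  exact S.2

theorem polylogSum_mem_polylogAlg {T : NCSeries} (hT : T ∈ NCSeries.starAlgebra) :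
    polylogSum T ∈ polylogAlg := by
  obtain ⟨S, hS, rfl⟩ := starAlgebra_le hT
  exact hS

/-- The extension of `Li_•` to the star algebra. -/
def polylogMorphism : NCSeries.starAlgebra →ₐ[ℂ] polylogAlg :=
  (polylogSumHom.comp (Subalgebra.inclusion fun _ hT => isNormal_of_mem_starAlgebra hT)).codRestrict
    polylogAlg fun T => polylogSum_mem_polylogAlg T.2

/-- The image is closed under sums and products and contains `z`, `z⁻¹`, `(1-z)⁻¹` (from the stars),
the constants and all the `Li_w`. -/
theorem polylogMorphism_surjective : Function.Surjective polylogMorphism := by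
  have hadd : ∀ f g : CleftFun, (∃ T ∈ NCSeries.starAlgebra, polylogSum T = f) →
      (∃ T ∈ NCSeries.starAlgebra, polylogSum T = g) →
      ∃ T ∈ NCSeries.starAlgebra, polylogSum T = f + g := by
    rintro _ _ ⟨S, hS, rfl⟩ ⟨T, hT, rfl⟩
    exact ⟨S + T, add_mem hS hT, polylogSum_add (isNormal_of_mem_starAlgebra hS)
      (isNormal_of_mem_starAlgebra hT)⟩
  have hmul : ∀ f g : CleftFun, (∃ T ∈ NCSeries.starAlgebra, polylogSum T = f) →
      (∃ T ∈ NCSeries.starAlgebra, polylogSum T = g) →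
      ∃ T ∈ NCSeries.starAlgebra, polylogSum T = f * g := by
    rintro _ _ ⟨S, hS, rfl⟩ ⟨T, hT, rfl⟩
    exact ⟨S * T, mul_mem hS hT, polylogSum_mul (isNormal_of_mem_starAlgebra hS)
      (isNormal_of_mem_starAlgebra hT)⟩
  have hrat : ∀ f ∈ rationalAlg, ∃ T ∈ NCSeries.starAlgebra, polylogSum T = f := by
    intro f hf
    induction hf using Algebra.adjoin_induction with
    | mem f hf =>
      rcases hf with rfl | rfl | rfl
      · exact ⟨_, (le_sup_left.trans (le_sup_left.trans le_sup_left) :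
          Algebra.adjoin ℂ {NCSeries.star ![1, 0]} ≤ NCSeries.starAlgebra)
            (Algebra.subset_adjoin rfl), polylogSum_star_pos⟩
      · exact ⟨_, (le_sup_right.trans (le_sup_left.trans le_sup_left) :
          Algebra.adjoin ℂ {NCSeries.star ![-1, 0]} ≤ NCSeries.starAlgebra)
            (Algebra.subset_adjoin rfl), polylogSum_star_neg⟩
      · exact ⟨_, (le_sup_right.trans le_sup_left :
          Algebra.adjoin ℂ {NCSeries.star ![0, 1]} ≤ NCSeries.starAlgebra)
            (Algebra.subset_adjoin rfl), polylogSum_star_one⟩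
    | algebraMap c =>
      refine ⟨c • NCSeries.word [], Subalgebra.smul_mem _ (NCSeries.word_mem_starAlgebra _) c, ?_⟩
      rw [polylogSum_smul, polylogSum_word, polylog_nil, Algebra.algebraMap_eq_smul_one]
    | add f g _ _ hf hg => exact hadd f g hf hg
    | mul f g _ _ hf hg => exact hmul f g hf hg
  rintro ⟨f, hf⟩
  obtain ⟨T, hT, rfl⟩ := polylogAlg_induction (P := fun f =>
    ∃ T ∈ NCSeries.starAlgebra, polylogSum T = f)
    (fun w => ⟨_, NCSeries.word_mem_starAlgebra w, polylogSum_word w⟩) hrat hadd hmul hf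
  exact ⟨⟨T, hT⟩, rfl⟩

end

theorem mainTheorem3 :
    (LinearIndependent ℂ polylogB ∧
      Submodule.span ℂ (Set.range polylogB) = Subalgebra.toSubmodule polylogAlg) ∧
    ∃ L : NCSeries.starAlgebra →ₐ[ℂ] polylogAlg,
      (∀ T : NCSeries.starAlgebra, HasIm (T : NCSeries) 1 (L T : CleftFun)) ∧
      (∀ w : XWord, (L ⟨NCSeries.word w, NCSeries.word_mem_starAlgebra w⟩ : CleftFun) = polylog w) ∧
      Function.Surjective L :=
  ⟨⟨linearIndependent_polylogB, span_polylogB_eq_polylogAlg⟩, polylogMorphism,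
    fun T => (isNormal_of_mem_starAlgebra T.2).hasIm, fun w => polylogSum_word w,
    polylogMorphism_surjective⟩
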